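/- **Model (AttEST).** Fix $d,m\ge 1$ and $N\ge 0$. A product $p$ is uniform on the unit sphere of $\mathbb{R}^d$. There are $m$ trigram vectors $v_k=s_k g_k$ ($1\le k\le m$), where $g_1,\dots,g_m$ are independent standard Gaussian vectors in $\mathbb{R}^d$ and the $s_k$ are real numbers with $|s_k|\le\kappa$. A position $i$ has a mixture parameter $\alpha_i\in(1/2,1]$ and a spread parameter $\beta_i\in\mathbb{R}$, $|\beta_i|\le B$. Put $Z_{p,i}=\sum_k \exp(\beta_i\langle v_k,p\rangle)$. Given the trigram vectors and $p$, a query $q=(t_1,\dots,t_{n})$ has a length $n=n(q)$ that is Poisson($\lambda$) conditioned on being at most $N$, with $\lambda>0$, and given $n$ its trigrams are independent, the $i$-th one being $v_k$ with probability $$P_{p,i}(k)=\alpha_i\frac{\exp(\beta_i\langle v_k,p\rangle)}{Z_{p,i}}+(1-\alpha_i)\frac1m .$$ For given trigram vectors, let $\Pr[q]$ be the probability, over $p$ and the trigram choices, that the model generates the sequence of trigrams $q$, conditioned on the length being $n(q)$. **Theorem.** For all $N$, $B$, $\kappa>0$ and $b>\kappa$ there are constants $C,c>0$, depending only on these, such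 that for all $d,m\ge1$ and all $s_k$, $\beta_i$ as above there are constants $Z_i>0$ (depending on neither the vectors $g_k$, nor the product, nor the query), such that for all $\alpha_i$ and $\lambda$ as above the following three statements hold simultaneously with probability at least $1-C e^{-c\log^2 m}-Ce^{-cd}$ over $g_1,\dots,g_m$. 1. For each position $i$ among the first $N$, with probability at least $1-Ce^{-c\log^2 m}$ over the uniform product $p$, $$(1-\varepsilon_z)Z_i\le Z_{p,i}\le(1+\varepsilon_z)Z_i,\qquad \varepsilon_z=C\,\frac{\log m}{\sqrt m}.$$ 2. A query generated by the model has, with probability at least $1-Ce^{-cd}$, only trigrams of norm at most $b\sqrt d$. 3. Every query $q=(t_1,\dots,t_{n(q)})$ of length at most $N$, all of whose trigrams have norm at most $b\sqrt d$, satisfies $$\Pr[q]=(1\pm\varepsilon'')\cdot\prod_{i=1}^{n(q)}\frac{\alpha_i}{Z_i}\cdot\exp\Big(\frac{\big\|\sum_{i=1}^{n(q)}\beta_i t_i\big\|^2}{2d}\Big),\qquad \varepsilon''=C\Big(\frac{\log m}{\sqrt m}+\sum_{i=1}^{n(q)}(1-\alpha_i)+\frac1d\Big).$$ Here $x=(1\pm\varepsilon)y$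 means $|x-y|\le\varepsilon y$. -/

import Mathlib

open MeasureTheory

noncomputable section

namespace AttEST

/-- `d`-dimensional Euclidean space, in which products and trigrams live. -/
abbrev E (d : ℕ) : Type := EuclideanSpace ℝ (Fin d)

/-- Products are unit vectors. -/
abbrev Product (d : ℕ) : Type := Metric.sphere (0 : E d) 1

/-- The uniform distribution on the unit sphere (normalised surface measure). -/
def productLaw (d : ℕ) : Measure (Product d) :=
  ((volume : Measure (E d)).toSphere Set.univ)⁻¹ • (volume : Measure (E d)).toSphere

/-- The law of `m` independent standard spherical Gaussian vectors in dimension `d`. -/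
def gaussianLaw (d m : ℕ) : Measure (Fin m → E d) :=
  Measure.pi fun _ => ProbabilityTheory.stdGaussian (E d)

/-- The trigram vectors `v k = s k • g k`, with scaling factors `s` and directions `g`. -/
def trigramVectors {d m : ℕ} (s : Fin m → ℝ) (g : Fin m → E d) : Fin m → E d :=
  fun k => s k • g k

/-- The partition function `Z_{p,i}` for the spread parameter `b = β i`. -/
def partitionFn {d m : ℕ} (v : Fin m → E d) (b : ℝ) (p : Product d) : ℝ :=
  ∑ k, Real.exp (b * inner ℝ (v k) (p : E d))

/-- The mixture probability `P_{p,i}` of the trigram `k`, for the mixture parameter `a = α i` and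
the spread parameter `b = β i`. -/
def trigramProb {d m : ℕ} (v : Fin m → E d) (a b : ℝ) (p : Product d) (k : Fin m) : ℝ :=
  a * (Real.exp (b * inner ℝ (v k) (p : E d)) / partitionFn v b p) + (1 - a) * (1 / m)

/-- The Poisson distribution with parameter `lam` conditioned on being at most `N`. -/
def lengthProb (lam : ℝ) (N n : ℕ) : ℝ :=
  (lam ^ n / n.factorial) / ∑ j ∈ Finset.range (N + 1), lam ^ j / j.factorial

/-- A query: a length `n ≤ N` and a sequence of `n` trigrams (given by their labels). -/
abbrev Query (m N : ℕ) : Type := Σ n : Fin (N + 1), (Fin n → Fin m)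

/-- The probability that the query `q` is generated when the user has the product `p` in mind:
the length is truncated Poisson, the trigrams are independent and the one in position `i` has
law `P_{p,i}`. Positions are numbered from `0`. -/
def queryProbGiven {d m : ℕ} (N : ℕ) (lam : ℝ) (v : Fin m → E d) (α β : ℕ → ℝ)
    (p : Product d) (q : Query m N) : ℝ :=
  lengthProb lam N q.1 * ∏ i : Fin q.1, trigramProb v (α i) (β i) p (q.2 i)

/-- The law of the query given the product `p`. -/
def queryLawGiven {d m : ℕ} (N : ℕ) (lam : ℝ) (v : Fin m → E d) (α β : ℕ → ℝ)
    (p : Product d) : Measure (Query m N) :=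
  ∑ q : Query m N, ENNReal.ofReal (queryProbGiven N lam v α β p q) • Measure.dirac q

/-- The law of a query of the model: first a uniform product, then a query for this product. -/
def queryLaw {d m : ℕ} (N : ℕ) (lam : ℝ) (v : Fin m → E d) (α β : ℕ → ℝ) :
    Measure (Query m N) :=
  (productLaw d).bind (queryLawGiven N lam v α β)

/-- The probability `Pr[q]` that the model generates the trigram sequence `q`, among the queries
of the same length as `q`. -/
def queryProb {d m : ℕ} (N : ℕ) (lam : ℝ) (v : Fin m → E d) (α β : ℕ → ℝ)
    (q : Query m N) : ℝ :=
  (ProbabilityTheory.cond (queryLaw N lam v α β) {q' | q'.1 = q.1}).real {q}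

/-- The approximation `∏ α i / Z i * exp (‖∑ β i • t i‖ ^ 2 / (2 * d))`. -/
def approxProb {d m N : ℕ} (v : Fin m → E d) (α β Z : ℕ → ℝ) (q : Query m N) : ℝ :=
  (∏ i : Fin q.1, α i / Z i) *
    Real.exp (‖∑ i : Fin q.1, β i • v (q.2 i)‖ ^ 2 / (2 * d))

/-- All the trigrams of `q` have norm at most `b * √d`. -/
def NormBounded {d m N : ℕ} (b : ℝ) (v : Fin m → E d) (q : Query m N) : Prop :=
  ∀ i, ‖v (q.2 i)‖ ≤ b * √d

/-- The error of the partition function concentration, with constant `C`. -/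
def epsZ (C : ℝ) (m : ℕ) : ℝ := C * (Real.log m / √m)

/-- The relative error of the approximation of `Pr[q]`, with constant `C`: the contributions of
the concentration of the partition functions, of the uniform components, and of the spherical
average. -/
def epsQuery {m N : ℕ} (C : ℝ) (d : ℕ) (α : ℕ → ℝ) (q : Query m N) : ℝ :=
  C * (Real.log m / √m + ∑ i : Fin q.1, (1 - α i) + 1 / d)

end AttEST

end

noncomputable section

namespace AttEST

open ProbabilityTheory Real

/-! For a fixed unit vector `p`, the partition function is a sum of `m` independent lognormal
variables whose Gaussian exponents have variance `(β i * s k) ^ 2`. Its mean `meanPartitionFn`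
therefore does not depend on `p`; this is the constant `Z i`, and it lies between `m` and a constant
times `m`. Truncation at `m ^ (1/4)` and a Chernoff bound give deviations of order `√m * log m`
except with probability `exp (-c * log m ^ 2)` (`partitionFn_concentration`). Fubini and Markov turn
"for every `p`, for most `g`" into "for most `g`, for most `p`", at the cost of a square root.

Where the partition functions are close to `Z i`, the trigram probability times `Z i / α i` is close
to `exp ⟪β i • t i, p⟫`: the normalisation contributes a relative error, the uniform component an
additive error of order `1 - α i`. The product over positions is then close to `∏ α i / Z i * exp
⟪V, p⟫` with `V = ∑ β i • t i`. Averaging over the sphere gives `exp (‖V‖ ^ 2 / (2 * d))` up to `O(1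
/ d)`: the Taylor coefficients of the spherical average are at most the Gaussian ones and differ
from them by a factor at least `1 - k * (k - 1) / d`, and `‖V‖ ^ 2 / d` is bounded because the
trigrams have norm at most `b * √d`. The exceptional `p` cost at most a power `m ^ N` relative to
the approximation, which `exp (-c * log m ^ 2)` absorbs (`abs_queryProb_sub_approxProb_le`).

For trigrams of large norm, the softmax weight is a ratio of dependent quantities. Cauchy–Schwarz
bounds the reciprocal of the denominator by an average of reciprocals, so only lognormal moments and
the Gaussian norm tail are needed (`sum_mul_softmax_le`). -/

/-! ### Normalisation of the laws and the standard Gaussian vector -/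

instance productLaw_isProbabilityMeasure {d : ℕ} [NeZero d] : IsProbabilityMeasure (productLaw d) := by
  constructor
  have h0 : (volume : Measure (E d)).toSphere Set.univ ≠ 0 := by
    rw [Ne, Measure.measure_univ_eq_zero, Measure.toSphere_eq_zero_iff_finrank]
    simpa using NeZero.ne d
  simp only [productLaw, Measure.smul_apply, smul_eq_mul]
  exact ENNReal.inv_mul_cancel h0 (measure_ne_top _ _)

instance gaussianLaw_isProbabilityMeasure {d m : ℕ} : IsProbabilityMeasure (gaussianLaw d m) := by
  unfold gaussianLaw; infer_instance

/-- The standard Gaussian density on `E d`. -/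
def gaussianDensity (d : ℕ) (x : E d) : ℝ := (2 * π) ^ (-(d / 2 : ℝ)) * exp (-(1 / 2) * ‖x‖ ^ 2)

lemma gaussianDensity_nonneg (d : ℕ) (x : E d) : 0 ≤ gaussianDensity d x := by
  unfold gaussianDensity; positivity

@[fun_prop]
lemma measurable_gaussianDensity (d : ℕ) : Measurable (gaussianDensity d) := by
  unfold gaussianDensity; fun_prop

lemma integral_exp_neg_mul_sq_norm {d : ℕ} {b : ℝ} (hb : 0 < b) :
    ∫ x : E d, exp (-b * ‖x‖ ^ 2) = (π / b) ^ (d / 2 : ℝ) := by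
  have := GaussianFourier.integral_rexp_neg_mul_sq_norm (V := E d) hb
  simpa using this

lemma integrable_exp_neg_mul_sq_norm {d : ℕ} {b : ℝ} (hb : 0 < b) :
    Integrable fun x : E d => exp (-b * ‖x‖ ^ 2) := by
  -- The integral of a non-integrable function is `0` by convention, which contradicts the positive
  -- value.
  by_contra h
  have h1 := integral_exp_neg_mul_sq_norm (d := d) hb
  rw [integral_undef h] at h1
  have : 0 < (π / b) ^ (d / 2 : ℝ) := by positivity
  linarith

lemma integrable_gaussianDensity (d : ℕ) : Integrable (gaussianDensity d) :=
  (integrable_exp_neg_mul_sq_norm (by norm_num)).const_mul _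

/-- Both finite measures have characteristic function `exp (-‖t‖ ^ 2 / 2)`, by the Gaussian Fourier
integral. -/
lemma stdGaussian_eq_withDensity (d : ℕ) :
    stdGaussian (E d) = volume.withDensity fun x => ENNReal.ofReal (gaussianDensity d x) := by
  have hfin : IsFiniteMeasure
      ((volume : Measure (E d)).withDensity fun x => ENNReal.ofReal (gaussianDensity d x)) :=
    isFiniteMeasure_withDensity_ofReal (integrable_gaussianDensity d).2
  refine Measure.ext_of_charFun ?_
  ext t
  rw [charFun_stdGaussian, charFun_apply,
    integral_withDensity_eq_integral_toReal_smul (by fun_prop) (by simp)]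
  have key := GaussianFourier.integral_cexp_neg_mul_sq_norm_add (V := E d) (b := 1 / 2)
    (by norm_num) Complex.I t
  have hc : ((2 * π : ℝ) : ℂ) ^ (d / 2 : ℂ) ≠ 0 := by
    rw [Complex.cpow_ne_zero_iff]; left; exact_mod_cast (by positivity : (2 * π : ℝ) ≠ 0)
  have : ∀ x : E d, (ENNReal.ofReal (gaussianDensity d x)).toReal •
      Complex.exp (inner ℝ x t * Complex.I) =
      ((2 * π : ℝ) : ℂ) ^ (-(d / 2 : ℂ)) *
        Complex.exp (-(1 / 2) * ‖x‖ ^ 2 + Complex.I * inner ℝ t x) := by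
    intro x
    rw [ENNReal.toReal_ofReal (gaussianDensity_nonneg d x), gaussianDensity, Complex.real_smul,
      Complex.ofReal_mul, Complex.exp_add, real_inner_comm, Complex.ofReal_cpow (by positivity)]
    push_cast
    ring_nf
  simp_rw [this]
  rw [integral_const_mul, key, Complex.cpow_neg]
  have e1 : (π : ℂ) / (1 / 2) = ((2 * π : ℝ) : ℂ) := by push_cast; ring
  simp only [finrank_euclideanSpace, Fintype.card_fin, e1]
  rw [inv_mul_cancel_left₀ hc, Complex.I_sq]
  congr 1; ring

lemma integral_stdGaussian {d : ℕ} (f : E d → ℝ) :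
    ∫ x, f x ∂stdGaussian (E d) = ∫ x, gaussianDensity d x * f x := by
  rw [stdGaussian_eq_withDensity,
    integral_withDensity_eq_integral_toReal_smul (by fun_prop) (by simp)]
  simp [ENNReal.toReal_ofReal (gaussianDensity_nonneg d _)]

lemma map_inner_stdGaussian {d : ℕ} (a : E d) :
    (stdGaussian (E d)).map (fun x => inner ℝ a x) = gaussianReal 0 (‖a‖ ^ 2).toNNReal := by
  have := IsGaussian.map_eq_gaussianReal (μ := stdGaussian (E d)) (innerSL ℝ a)
  rw [integral_strongDual_stdGaussian, variance_dual_stdGaussian] at this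
  simpa using this

lemma integrable_exp_inner_stdGaussian {d : ℕ} (a : E d) :
    Integrable (fun x => exp (inner ℝ a x)) (stdGaussian (E d)) := by
  have h := integrable_exp_mul_gaussianReal (μ := 0) (v := (‖a‖ ^ 2).toNNReal) 1
  rw [← map_inner_stdGaussian, integrable_map_measure (by fun_prop) (by fun_prop)] at h
  simpa [Function.comp_def] using h

lemma integral_exp_inner_stdGaussian {d : ℕ} (a : E d) :
    ∫ x, exp (inner ℝ a x) ∂stdGaussian (E d) = exp (‖a‖ ^ 2 / 2) := by
  have h := mgf_gaussianReal (map_inner_stdGaussian a) 1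
  simp only [mgf, one_mul] at h
  rw [h, Real.coe_toNNReal _ (by positivity)]
  ring_nf

/-- Chernoff bound for the norm of a standard Gaussian vector. -/
lemma stdGaussian_norm_tail {d : ℕ} {r : ℝ} (hr : 1 < r) :
    (stdGaussian (E d)).real {x | r * √d < ‖x‖} ≤ exp (-((r ^ 2 - 1 - log (r ^ 2)) / 2) * d) := by
  -- The optimal Chernoff parameter: `E exp (s * ‖x‖ ^ 2) = (1 - 2 * s) ^ (-d / 2)`, and minimising
  -- the bound gives `1 - 2 * s = r⁻²`.
  set s : ℝ := (1 - (r ^ 2)⁻¹) / 2 with hs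
  have hr2 : 1 < r ^ 2 := by nlinarith
  have hs0 : 0 < s := by
    have : (r ^ 2)⁻¹ < 1 := inv_lt_one_of_one_lt₀ hr2
    rw [hs]; linarith
  have hb : (0 : ℝ) < (r ^ 2)⁻¹ / 2 := by positivity
  have hprod : ∀ x : E d, gaussianDensity d x * exp (s * ‖x‖ ^ 2) =
      (2 * π) ^ (-(d / 2 : ℝ)) * exp (-((r ^ 2)⁻¹ / 2) * ‖x‖ ^ 2) := by
    intro x
    rw [gaussianDensity, mul_assoc, ← exp_add, hs]; ring_nf
  have hint : ∫ x, exp (s * ‖x‖ ^ 2) ∂stdGaussian (E d) = (r ^ 2) ^ (d / 2 : ℝ) := by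
    rw [integral_stdGaussian]
    simp_rw [hprod]
    rw [integral_const_mul, integral_exp_neg_mul_sq_norm hb, rpow_neg (by positivity),
      show π / ((r ^ 2)⁻¹ / 2) = (2 * π) * r ^ 2 by field_simp,
      mul_rpow (x := 2 * π) (y := r ^ 2) (by positivity) (by positivity),
      inv_mul_cancel_left₀ (by positivity)]
  have hI : Integrable (fun x => exp (s * ‖x‖ ^ 2)) (stdGaussian (E d)) := by
    by_contra h
    rw [integral_undef h] at hint
    have : 0 < (r ^ 2) ^ (d / 2 : ℝ) := by positivity
    linarith
  have hM := mul_meas_ge_le_integral_of_nonneg (μ := stdGaussian (E d))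
    (Filter.Eventually.of_forall fun x => (exp_pos (s * ‖x‖ ^ 2)).le) hI (exp (s * (r ^ 2 * d)))
  have hsub : (stdGaussian (E d)).real {x | r * √d < ‖x‖} ≤
      (stdGaussian (E d)).real {x | exp (s * (r ^ 2 * d)) ≤ exp (s * ‖x‖ ^ 2)} := by
    refine measureReal_mono (fun x hx => ?_)
    have hx' : r * √d < ‖x‖ := hx
    have : (r * √d) ^ 2 ≤ ‖x‖ ^ 2 := pow_le_pow_left₀ (by positivity) hx'.le 2
    rw [mul_pow, Real.sq_sqrt (Nat.cast_nonneg _)] at this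
    exact exp_le_exp.2 (mul_le_mul_of_nonneg_left this hs0.le)
  rw [hint] at hM
  refine hsub.trans ?_
  have hpos := exp_pos (s * (r ^ 2 * d))
  rw [← mul_le_mul_iff_right₀ hpos]
  refine hM.trans (le_of_eq ?_)
  rw [rpow_def_of_pos (by positivity), ← exp_add]
  congr 1
  rw [hs]
  field_simp
  ring

/-! ### Moments and moment generating function of the uniform law on the sphere -/

/-- The absolute half-line moments of the Gaussian weight. -/
def radialMoment (n : ℕ) : ℝ := ∫ r in Set.Ioi (0 : ℝ), r ^ n * exp (-(1 / 2) * r ^ 2)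

lemma radialMoment_eq (n : ℕ) :
    radialMoment n = (1 / 2 : ℝ) ^ (-(n + 1 : ℝ) / 2) * (1 / 2) * Gamma ((n + 1) / 2) := by
  rw [← integral_rpow_mul_exp_neg_mul_rpow (p := 2) (q := n) (b := 1 / 2) (by norm_num)
    (by have : (0 : ℝ) ≤ n := n.cast_nonneg
        linarith) (by norm_num), radialMoment]
  simp [rpow_natCast]

lemma radialMoment_pos (n : ℕ) : 0 < radialMoment n := by
  rw [radialMoment_eq]
  have : 0 < Gamma ((n + 1 : ℝ) / 2) := Gamma_pos_of_pos (by positivity)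
  positivity

/-- The functional equation of `Gamma`. With positivity, this recursion is all that the ratios of
moments below require. -/
lemma radialMoment_add_two (n : ℕ) : radialMoment (n + 2) = (n + 1) * radialMoment n := by
  rw [radialMoment_eq, radialMoment_eq]
  have e1 : (((n + 2 : ℕ) : ℝ) + 1) / 2 = (n + 1) / 2 + 1 := by push_cast; ring
  have e2 : -(((n + 2 : ℕ) : ℝ) + 1) / 2 = -(n + 1 : ℝ) / 2 + (-1) := by push_cast; ring
  rw [e1, e2, Gamma_add_one (by positivity), rpow_add (by norm_num), rpow_neg_one]
  ring

lemma integral_pow_gaussianReal (n : ℕ) :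
    ∫ y, y ^ (2 * n) ∂gaussianReal 0 1 = radialMoment (2 * n) / radialMoment 0 := by
  have h : ∀ k : ℕ, ∫ y, y ^ (2 * k) ∂gaussianReal 0 1 =
      (√(2 * π))⁻¹ * (2 * radialMoment (2 * k)) := by
    intro k
    rw [integral_gaussianReal_eq_integral_smul (by norm_num)]
    have : ∀ y : ℝ, gaussianPDFReal 0 1 y • y ^ (2 * k) =
        (√(2 * π))⁻¹ * (|y| ^ (2 * k) * exp (-(1 / 2) * |y| ^ 2)) := by
      intro y
      rw [gaussianPDFReal_def, pow_mul |y|, sq_abs, ← pow_mul]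
      simp
      ring_nf
    simp_rw [this]
    rw [integral_const_mul, integral_comp_abs
      (f := fun y => y ^ (2 * k) * exp (-(1 / 2) * y ^ 2)), radialMoment]
  -- The zeroth moment is `1`; this identifies the normalising constant without evaluating
  -- `radialMoment 0`.
  have h0 := h 0
  simp only [mul_zero, pow_zero, integral_const, probReal_univ, smul_eq_mul, mul_one] at h0
  rw [h n, eq_div_iff (radialMoment_pos 0).ne']
  linear_combination (-radialMoment (2 * n)) * h0

lemma integral_odd_pow_gaussianReal (n : ℕ) : ∫ y, y ^ (2 * n + 1) ∂gaussianReal 0 1 = 0 := by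
  have h := gaussianReal_map_neg (μ := 0) (v := 1)
  rw [neg_zero] at h
  have : ∫ y, y ^ (2 * n + 1) ∂gaussianReal 0 1 = -∫ y, y ^ (2 * n + 1) ∂gaussianReal 0 1 := by
    conv_lhs => rw [← h]
    rw [integral_map (by fun_prop) (by fun_prop), ← integral_neg]
    congr with y
    exact Odd.neg_pow ⟨n, rfl⟩ y
  linarith

lemma integral_inner_pow_stdGaussian {d : ℕ} (a : E d) (n : ℕ) :
    ∫ x, inner ℝ a x ^ n ∂stdGaussian (E d) = ‖a‖ ^ n * ∫ y, y ^ n ∂gaussianReal 0 1 := by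
  have h1 : (gaussianReal 0 1).map (fun y => ‖a‖ * y) =
      (stdGaussian (E d)).map (fun x => inner ℝ a x) := by
    rw [map_inner_stdGaussian, gaussianReal_map_const_mul]
    congr 1
    · simp
    · ext; simp
  have h2 := congrArg (fun μ => ∫ y, y ^ n ∂μ) h1
  simp only at h2
  rw [integral_map (by fun_prop) (by fun_prop), integral_map (by fun_prop) (by fun_prop)] at h2
  rw [← h2, ← integral_const_mul]
  simp_rw [mul_pow]

/-- Polar coordinates for homogeneous polynomials against the Gaussian weight. -/
lemma integral_inner_pow_mul_exp {d : ℕ} [NeZero d] (a : E d) (n : ℕ) :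
    ∫ x : E d, inner ℝ a x ^ n * exp (-(1 / 2) * ‖x‖ ^ 2) =
      (∫ p : Product d, inner ℝ a (p : E d) ^ n ∂(volume : Measure (E d)).toSphere) *
        radialMoment (d - 1 + n) := by
  have hfr : Module.finrank ℝ (E d) = d := by simp
  have := Fin.pos_iff_nonempty.1 (Nat.pos_of_ne_zero (NeZero.ne d))
  set F : E d → ℝ := fun x => inner ℝ a x ^ n * exp (-(1 / 2) * ‖x‖ ^ 2) with hF
  calc
    ∫ x, F x = ∫ x : ({(0)}ᶜ : Set (E d)), F x.1 ∂((volume : Measure (E d)).comap (↑)) := by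
      rw [integral_subtype_comap (measurableSet_singleton _).compl F, restrict_compl_singleton]
    _ = ∫ y : Product d × Set.Ioi (0 : ℝ),
          inner ℝ a (y.1 : E d) ^ n * ((y.2 : ℝ) ^ n * exp (-(1 / 2) * (y.2 : ℝ) ^ 2))
          ∂(volume : Measure (E d)).toSphere.prod (.volumeIoiPow (d - 1)) := by
      have h := (volume : Measure (E d)).measurePreserving_homeomorphUnitSphereProd.integral_comp
        (Homeomorph.measurableEmbedding _)
        (fun y : Product d × Set.Ioi (0 : ℝ) =>
          inner ℝ a (y.1 : E d) ^ n * ((y.2 : ℝ) ^ n * exp (-(1 / 2) * (y.2 : ℝ) ^ 2)))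
      rw [hfr] at h
      rw [← h]
      congr with x
      have hx : ‖(x : E d)‖ ≠ 0 := norm_ne_zero_iff.2 x.2
      simp only [hF, homeomorphUnitSphereProd_apply_fst_coe, homeomorphUnitSphereProd_apply_snd_coe,
        inner_smul_right]
      rw [← mul_assoc, ← mul_pow, mul_comm (‖(x : E d)‖⁻¹), inv_mul_cancel_right₀ hx]
    _ = _ := by
      rw [integral_prod_mul (fun p : Product d => inner ℝ a (p : E d) ^ n)
        (fun r : Set.Ioi (0 : ℝ) => (r : ℝ) ^ n * exp (-(1 / 2) * (r : ℝ) ^ 2))]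
      congr 1
      simp only [Measure.volumeIoiPow, ENNReal.ofReal]
      rw [integral_withDensity_eq_integral_smul
          ((measurable_subtype_coe.pow_const _).real_toNNReal),
        integral_subtype_comap measurableSet_Ioi
          fun r : ℝ => Real.toNNReal (r ^ (d - 1)) • (r ^ n * exp (-(1 / 2) * r ^ 2)), radialMoment]
      refine setIntegral_congr_fun measurableSet_Ioi fun r hr => ?_
      simp only [NNReal.smul_def, smul_eq_mul]
      rw [Real.coe_toNNReal _ (pow_nonneg (le_of_lt hr) _)]
      ring

/-- A Gaussian vector is its norm times an independent uniform direction, so its moments factor into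
a spherical and a radial part. The case of exponent `0` supplies the surface area of the sphere. -/
lemma integral_inner_pow_productLaw {d : ℕ} [NeZero d] (a : E d) (n : ℕ) :
    (∫ p : Product d, inner ℝ a (p : E d) ^ n ∂productLaw d) * radialMoment (d - 1 + n) =
      radialMoment (d - 1) * (‖a‖ ^ n * ∫ y, y ^ n ∂gaussianReal 0 1) := by
  set c : ℝ := (2 * π) ^ (-(d / 2 : ℝ)) with hc
  have key : ∀ k : ℕ, c * ((∫ p : Product d, inner ℝ a (p : E d) ^ k
      ∂(volume : Measure (E d)).toSphere) * radialMoment (d - 1 + k)) =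
      ‖a‖ ^ k * ∫ y, y ^ k ∂gaussianReal 0 1 := by
    intro k
    rw [← integral_inner_pow_mul_exp, ← integral_inner_pow_stdGaussian, integral_stdGaussian,
      ← integral_const_mul]
    congr with x
    rw [gaussianDensity]; ring
  have h0 := key 0
  simp only [pow_zero, integral_const, smul_eq_mul, mul_one, add_zero, probReal_univ] at h0
  have hn := key n
  rw [← hn, productLaw, integral_smul_measure, ENNReal.toReal_inv, smul_eq_mul]
  change ((volume : Measure (E d)).toSphere.real Set.univ)⁻¹ * _ * _ = _
  have hS : (volume : Measure (E d)).toSphere.real Set.univ ≠ 0 := by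
    intro h; rw [h] at h0; simp at h0
  field_simp
  linear_combination (-radialMoment (d - 1 + n) * ∫ p : Product d, inner ℝ a (p : E d) ^ n
      ∂(volume : Measure (E d)).toSphere) * h0

/-- The even Taylor terms of the spherical moment generating function. -/
lemma sphere_mgf_term {d : ℕ} [NeZero d] (a : E d) (k : ℕ) :
    (∫ p : Product d, inner ℝ a (p : E d) ^ (2 * k) ∂productLaw d) / (2 * k).factorial =
      (‖a‖ ^ 2 / (2 * d)) ^ k / k.factorial * (d ^ k / ∏ j ∈ Finset.range k, (d + 2 * j : ℝ)) := by
  have hd : 0 < d := Nat.pos_of_ne_zero (NeZero.ne d)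
  have hd' : (0 : ℝ) < d := Nat.cast_pos.2 hd
  have hP : ∀ k : ℕ, 0 < ∏ j ∈ Finset.range k, (d + 2 * j : ℝ) :=
    fun k => Finset.prod_pos fun j _ => by positivity
  -- Iterating the recursion yields the factors `d, d + 2, …, d + 2 * (k - 1)`.
  have h1 : ∀ k : ℕ, radialMoment (d - 1 + 2 * k) =
      (∏ j ∈ Finset.range k, (d + 2 * j : ℝ)) * radialMoment (d - 1) := by
    intro k
    induction k with
    | zero => simp
    | succ k ih =>
      rw [Finset.prod_range_succ, show d - 1 + 2 * (k + 1) = d - 1 + 2 * k + 2 by ring,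
        radialMoment_add_two, ih]
      push_cast [Nat.cast_sub hd]
      ring
  -- The even Gaussian moments are `(2k)! / (2 ^ k * k!)`.
  have h2 : ∀ k : ℕ, radialMoment (2 * k) / radialMoment 0 / (2 * k).factorial =
      1 / (2 ^ k * k.factorial) := by
    intro k
    have h0 := (radialMoment_pos 0).ne'
    induction k with
    | zero => simp [h0]
    | succ k ih =>
      have hf : ((2 * k).factorial : ℝ) ≠ 0 := by positivity
      rw [show 2 * (k + 1) = 2 * k + 2 by ring, radialMoment_add_two, Nat.factorial_succ,
        Nat.factorial_succ, Nat.factorial_succ]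
      have hr : radialMoment (2 * k) =
        1 / (2 ^ k * k.factorial) * radialMoment 0 * (2 * k).factorial := by
        rw [← ih]; field_simp
      rw [hr]
      push_cast
      field_simp
      ring
  have key := integral_inner_pow_productLaw a (2 * k)
  rw [integral_pow_gaussianReal, h1] at key
  have hJ := (radialMoment_pos (d - 1)).ne'
  have hJ0 := (radialMoment_pos 0).ne'
  have hPk := (hP k).ne'
  have hf : ((2 * k).factorial : ℝ) ≠ 0 := by positivity
  have h2k := h2 k
  have e : (∫ p : Product d, inner ℝ a (p : E d) ^ (2 * k) ∂productLaw d) =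
      ‖a‖ ^ (2 * k) * (radialMoment (2 * k) / radialMoment 0) /
        ∏ j ∈ Finset.range k, (d + 2 * j : ℝ) := by
    rw [eq_div_iff hPk]
    apply mul_right_cancel₀ hJ
    linear_combination key
  have hr : radialMoment (2 * k) / radialMoment 0 =
      1 / (2 ^ k * k.factorial) * (2 * k).factorial := by
    rw [← h2k]; field_simp
  rw [e, hr, div_pow, mul_pow, pow_mul]
  field_simp

lemma sphere_mgf_factor_le {d : ℕ} (hd : 0 < d) (k : ℕ) :
    (d : ℝ) ^ k / ∏ j ∈ Finset.range k, (d + 2 * j : ℝ) ≤ 1 := by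
  have hd' : (0 : ℝ) < d := Nat.cast_pos.2 hd
  rw [div_le_one (Finset.prod_pos fun j _ => by positivity)]
  calc (d : ℝ) ^ k = ∏ _j ∈ Finset.range k, (d : ℝ) := by simp
    _ ≤ _ := Finset.prod_le_prod (fun _ _ => hd'.le) fun j _ => by
      linarith [(j.cast_nonneg : (0 : ℝ) ≤ j)]

/-- Each factor `d / (d + 2 * j)` is at least `1 - 2 * j / d`, and the defects add up to `k * (k -
1) / d`. The upper bound `1` on the partial products makes the induction work even where `1 - 2 * k
/ d` is negative. -/
lemma le_sphere_mgf_factor {d : ℕ} (hd : 0 < d) (k : ℕ) :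
    1 - k * (k - 1) / d ≤ (d : ℝ) ^ k / ∏ j ∈ Finset.range k, (d + 2 * j : ℝ) := by
  have hd' : (0 : ℝ) < d := Nat.cast_pos.2 hd
  induction k with
  | zero => simp
  | succ k ih =>
    have hle := sphere_mgf_factor_le hd k
    set t : ℝ := (d : ℝ) ^ k / ∏ j ∈ Finset.range k, (d + 2 * j : ℝ) with ht
    have ht0 : 0 ≤ t := div_nonneg (by positivity) (Finset.prod_nonneg fun j _ => by positivity)
    have hk : (0 : ℝ) ≤ k := k.cast_nonneg
    have e : (d : ℝ) ^ (k + 1) / ∏ j ∈ Finset.range (k + 1), (d + 2 * j : ℝ) =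
        t * (d / (d + 2 * k)) := by
      rw [Finset.prod_range_succ, pow_succ, ht, div_mul_div_comm]
    have e2 : 1 - 2 * k / d ≤ (d : ℝ) / (d + 2 * k) := by
      rw [le_div_iff₀ (by positivity)]
      have : (1 - 2 * k / d : ℝ) * (d + 2 * k) = d - 4 * k ^ 2 / d := by field_simp; ring
      rw [this]
      have : 0 ≤ 4 * (k : ℝ) ^ 2 / d := by positivity
      linarith
    rw [e]
    calc 1 - ((k + 1 : ℕ) : ℝ) * ((k + 1 : ℕ) - 1) / d
        = (1 - k * (k - 1) / d) - 2 * k / d := by push_cast; field_simp; ring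
      _ ≤ t - 2 * k / d * t := by
          have : 2 * k / d * t ≤ 2 * k / d * 1 := mul_le_mul_of_nonneg_left hle (by positivity)
          linarith
      _ = t * (1 - 2 * k / d) := by ring
      _ ≤ _ := mul_le_mul_of_nonneg_left e2 ht0

lemma hasSum_of_congr {f g : ℕ → ℝ} {a : ℝ} (hf : HasSum f a) (h : ∀ k, f k = g k) :
    HasSum g a := by
  rwa [← funext h]

/-- The exponential series is integrated termwise, dominated by `‖a‖ ^ n / n!`; the odd moments
vanish by symmetry. -/
lemma hasSum_sphere_mgf {d : ℕ} [NeZero d] (a : E d) :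
    HasSum (fun k : ℕ => (‖a‖ ^ 2 / (2 * d)) ^ k / k.factorial *
        (d ^ k / ∏ j ∈ Finset.range k, (d + 2 * j : ℝ)))
      (∫ p : Product d, exp (inner ℝ a (p : E d)) ∂productLaw d) := by
  have hbd : ∀ (n : ℕ) (p : Product d), ‖inner ℝ a (p : E d) ^ n / (n.factorial : ℝ)‖ ≤
      ‖a‖ ^ n / n.factorial := by
    intro n p
    rw [norm_div, norm_pow, Real.norm_natCast]
    have := norm_inner_le_norm (𝕜 := ℝ) a (p : E d)
    rw [norm_eq_of_mem_sphere p, mul_one] at this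
    gcongr
  have hint : ∀ n : ℕ, Integrable
      (fun p : Product d => inner ℝ a (p : E d) ^ n / (n.factorial : ℝ)) (productLaw d) := fun n =>
    Integrable.of_bound (by fun_prop) (‖a‖ ^ n / n.factorial) (Filter.Eventually.of_forall (hbd n))
  have hs := hasSum_integral_of_summable_integral_norm hint
    (Summable.of_nonneg_of_le (fun n => integral_nonneg fun p => norm_nonneg _)
      (fun n => by
        refine (integral_mono (hint n).norm (integrable_const _) (hbd n)).trans ?_
        simp)
      (Real.summable_pow_div_factorial ‖a‖))
  have e : ∀ p : Product d, ∑' n : ℕ, inner ℝ a (p : E d) ^ n / (n.factorial : ℝ) =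
      exp (inner ℝ a (p : E d)) := fun p => by
    rw [Real.exp_eq_exp_ℝ, NormedSpace.exp_eq_tsum_div]
  simp_rw [e] at hs
  have hinj : Function.Injective fun k : ℕ => 2 * k := fun x y h => by simpa using h
  rw [← hinj.hasSum_iff] at hs
  · refine hasSum_of_congr hs fun k => ?_
    rw [Function.comp_apply, integral_div, sphere_mgf_term]
  · intro n hn
    have hodd : ∃ k, n = 2 * k + 1 := by
      rcases Nat.even_or_odd' n with ⟨k, rfl | rfl⟩
      · exact absurd ⟨k, rfl⟩ hn
      · exact ⟨k, rfl⟩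
    obtain ⟨k, rfl⟩ := hodd
    have key := integral_inner_pow_productLaw a (2 * k + 1)
    rw [integral_odd_pow_gaussianReal, mul_zero, mul_zero, mul_eq_zero] at key
    rw [integral_div, key.resolve_right (radialMoment_pos _).ne', zero_div]

lemma hasSum_pow_div_factorial (x : ℝ) : HasSum (fun k : ℕ => x ^ k / k.factorial) (exp x) := by
  rw [Real.exp_eq_exp_ℝ]; exact NormedSpace.expSeries_div_hasSum_exp x

lemma integral_exp_inner_productLaw_le {d : ℕ} [NeZero d] (a : E d) :
    ∫ p : Product d, exp (inner ℝ a (p : E d)) ∂productLaw d ≤ exp (‖a‖ ^ 2 / (2 * d)) := by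
  refine hasSum_le (fun k => ?_) (hasSum_sphere_mgf a) (hasSum_pow_div_factorial _)
  exact mul_le_of_le_one_right (by positivity)
    (sphere_mgf_factor_le (Nat.pos_of_ne_zero (NeZero.ne d)) k)

/-- Termwise comparison reduces the loss to `∑ k * (k - 1) * x ^ k / k! = x ^ 2 * exp x`, divided by
`d`. -/
lemma le_integral_exp_inner_productLaw {d : ℕ} [NeZero d] (a : E d) :
    exp (‖a‖ ^ 2 / (2 * d)) * (1 - (‖a‖ ^ 2 / (2 * d)) ^ 2 / d) ≤
      ∫ p : Product d, exp (inner ℝ a (p : E d)) ∂productLaw d := by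
  set x := ‖a‖ ^ 2 / (2 * d) with hx
  have h2 : HasSum (fun k : ℕ => k * (k - 1) * (x ^ k / k.factorial)) (x ^ 2 * exp x) := by
    rw [← hasSum_nat_add_iff' 2]
    simp only [Finset.sum_range_succ, Finset.sum_range_zero]
    simp only [CharP.cast_eq_zero, zero_mul, Nat.cast_one, sub_self, mul_zero, add_zero, sub_zero]
    refine hasSum_of_congr ((hasSum_pow_div_factorial x).mul_left (x ^ 2)) fun k => ?_
    rw [Nat.factorial_succ, Nat.factorial_succ]
    push_cast
    field_simp
    ring
  have h3 : HasSum (fun k : ℕ => x ^ k / k.factorial * (1 - k * (k - 1) / d))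
      (exp x * (1 - x ^ 2 / d)) := by
    have h := (hasSum_pow_div_factorial x).sub (h2.div_const d)
    rw [show exp x * (1 - x ^ 2 / d) = exp x - x ^ 2 * exp x / d by ring]
    exact hasSum_of_congr h fun k => by ring
  refine hasSum_le (fun k => ?_) h3 (hasSum_sphere_mgf a)
  exact mul_le_mul_of_nonneg_left (le_sphere_mgf_factor (Nat.pos_of_ne_zero (NeZero.ne d)) k)
    (by positivity)

/-! ### Probabilities in the query model -/

lemma partitionFn_pos {d m : ℕ} [NeZero m] (v : Fin m → E d) (b : ℝ) (p : Product d) :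
    0 < partitionFn v b p :=
  Finset.sum_pos (fun _ _ => exp_pos _) Finset.univ_nonempty

lemma trigramProb_nonneg {d m : ℕ} (v : Fin m → E d) {a : ℝ} (ha : 0 ≤ a ∧ a ≤ 1) (b : ℝ)
    (p : Product d) (k : Fin m) : 0 ≤ trigramProb v a b p k := by
  have h1 : 0 ≤ partitionFn v b p := Finset.sum_nonneg fun _ _ => (exp_pos _).le
  have h2 : 0 ≤ 1 - a := by linarith [ha.2]
  have := ha.1
  unfold trigramProb
  positivity

lemma sum_trigramProb {d m : ℕ} [NeZero m] (v : Fin m → E d) (a b : ℝ) (p : Product d) :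
    ∑ k, trigramProb v a b p k = 1 := by
  have h := (partitionFn_pos v b p).ne'
  have hm : (m : ℝ) ≠ 0 := Nat.cast_ne_zero.2 (NeZero.ne m)
  simp only [trigramProb, Finset.sum_add_distrib, ← Finset.mul_sum, ← Finset.sum_div]
  rw [← partitionFn, div_self h]
  simp [hm]

lemma trigramProb_le_one {d m : ℕ} [NeZero m] (v : Fin m → E d) {a : ℝ} (ha : 0 ≤ a ∧ a ≤ 1)
    (b : ℝ) (p : Product d) (k : Fin m) : trigramProb v a b p k ≤ 1 := by
  rw [← sum_trigramProb v a b p]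
  exact Finset.single_le_sum (fun k _ => trigramProb_nonneg v ha b p k) (Finset.mem_univ k)

@[fun_prop]
lemma continuous_partitionFn {d m : ℕ} (v : Fin m → E d) (b : ℝ) :
    Continuous (partitionFn v b) := by
  unfold partitionFn; fun_prop

lemma continuous_trigramProb {d m : ℕ} [NeZero m] (v : Fin m → E d) (a b : ℝ) (k : Fin m) :
    Continuous fun p => trigramProb v a b p k := by
  unfold trigramProb
  have h := fun p => (partitionFn_pos v b p).ne'
  fun_prop (disch := exact h _)

lemma lengthProb_pos {lam : ℝ} (hl : 0 < lam) (N n : ℕ) : 0 < lengthProb lam N n := by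
  unfold lengthProb
  exact div_pos (by positivity)
    (Finset.sum_pos (fun _ _ => by positivity) ⟨0, by simp⟩)

lemma sum_lengthProb {lam : ℝ} (hl : 0 < lam) (N : ℕ) :
    ∑ n : Fin (N + 1), lengthProb lam N n = 1 := by
  rw [Fin.sum_univ_eq_sum_range (fun n => lengthProb lam N n)]
  simp only [lengthProb, ← Finset.sum_div]
  refine div_self (ne_of_gt ?_)
  exact Finset.sum_pos (fun _ _ => by positivity) ⟨0, by simp⟩

instance query_measurableSingletonClass {m N : ℕ} : MeasurableSingletonClass (Query m N) where
  measurableSet_singleton q := by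
    refine MeasurableSpace.measurableSet_iInf.2 fun n => ?_
    change MeasurableSet (Sigma.mk n ⁻¹' {q})
    exact (Set.to_countable _).measurableSet

lemma measurableSet_query {m N : ℕ} (s : Set (Query m N)) : MeasurableSet s :=
  s.to_countable.measurableSet

section law

variable {d m : ℕ} (N : ℕ) (lam : ℝ) (v : Fin m → E d) (α β : ℕ → ℝ)

lemma continuous_queryProbGiven [NeZero m] (q : Query m N) :
    Continuous fun p => queryProbGiven N lam v α β p q := by
  unfold queryProbGiven
  exact continuous_const.mul (continuous_finsetProd _ fun i _ => continuous_trigramProb v _ _ _)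

lemma queryLawGiven_apply (p : Product d) (s : Set (Query m N)) :
    queryLawGiven N lam v α β p s =
      ∑ q : Query m N, ENNReal.ofReal (queryProbGiven N lam v α β p q) * s.indicator 1 q := by
  simp [queryLawGiven, Measure.dirac_apply' _ (measurableSet_query s)]

lemma queryLaw_apply [NeZero m] (s : Set (Query m N)) :
    queryLaw N lam v α β s = ∫⁻ p, ∑ q : Query m N,
      ENNReal.ofReal (queryProbGiven N lam v α β p q) * s.indicator 1 q ∂productLaw d := by
  have hmeas : Measurable (queryLawGiven N lam v α β (d := d)) := by
    refine Measure.measurable_of_measurable_coe _ fun s _ => ?_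
    simp_rw [queryLawGiven_apply]
    have := continuous_queryProbGiven N lam v α β
    exact Finset.measurable_sum _ fun q _ => ((this q).measurable.ennreal_ofReal).mul_const _
  rw [queryLaw, Measure.bind_apply (measurableSet_query s) hmeas.aemeasurable]
  simp_rw [queryLawGiven_apply]

variable {lam} {α}

lemma queryProbGiven_nonneg (hl : 0 < lam) (hα : ∀ i, 0 ≤ α i ∧ α i ≤ 1) (p : Product d)
    (q : Query m N) : 0 ≤ queryProbGiven N lam v α β p q :=
  mul_nonneg (lengthProb_pos hl N _).le
    (Finset.prod_nonneg fun _ _ => trigramProb_nonneg v (hα _) _ _ _)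

lemma queryLaw_real_apply [NeZero m] (hl : 0 < lam) (hα : ∀ i, 0 ≤ α i ∧ α i ≤ 1) (s : Set (Query m N)) :
    (queryLaw N lam v α β).real s =
      ∫ p, ∑ q : Query m N, s.indicator (queryProbGiven N lam v α β p) q ∂productLaw d := by
  classical
  have hnn := queryProbGiven_nonneg N v β hl hα
  rw [measureReal_def, queryLaw_apply, integral_eq_lintegral_of_nonneg_ae]
  · congr 2 with p
    rw [ENNReal.ofReal_sum_of_nonneg fun q _ => Set.indicator_nonneg (fun q _ => hnn p q) q]
    refine Finset.sum_congr rfl fun q _ => ?_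
    by_cases hq : q ∈ s <;> simp [hq]
  · exact Filter.Eventually.of_forall fun p =>
      Finset.sum_nonneg fun q _ => Set.indicator_nonneg (fun q _ => hnn p q) q
  · refine Measurable.aestronglyMeasurable (Finset.measurable_sum _ fun q _ => ?_)
    by_cases hq : q ∈ s
    · simpa [hq] using (continuous_queryProbGiven N lam v α β q).measurable
    · simp [hq]

lemma sum_prod_trigramProb [NeZero m] (n : ℕ) (p : Product d) :
    ∑ t : Fin n → Fin m, ∏ i : Fin n, trigramProb v (α i) (β i) p (t i) = 1 := by
  rw [← Fintype.prod_sum fun (i : Fin n) k => trigramProb v (α i) (β i) p k]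
  simp [sum_trigramProb]

/-- The conditional probability of a trigram sequence is the average over the product of the
product of the trigram probabilities. -/
lemma queryProb_eq [NeZero d] [NeZero m] (hl : 0 < lam) (hα : ∀ i, 0 ≤ α i ∧ α i ≤ 1) (q : Query m N) :
    queryProb N lam v α β q =
      ∫ p, ∏ i : Fin q.1, trigramProb v (α i) (β i) p (q.2 i) ∂productLaw d := by
  classical
  have hlen := (lengthProb_pos hl N q.1).ne'
  -- The length is independent of the product, so the conditioning cancels exactly the length
  -- factor.
  have hA : (queryLaw N lam v α β).real {q' | q'.1 = q.1} = lengthProb lam N q.1 := by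
    rw [queryLaw_real_apply N v β hl hα]
    have : ∀ p : Product d, ∑ q' : Query m N, ({q' | q'.1 = q.1} : Set (Query m N)).indicator
        (queryProbGiven N lam v α β p) q' = lengthProb lam N q.1 := by
      intro p
      rw [Fintype.sum_sigma, Finset.sum_eq_single q.1]
      · simp [Set.indicator, queryProbGiven, ← Finset.mul_sum, sum_prod_trigramProb]
      · intro n _ hn
        simp [Set.indicator, hn]
      · simp
    simp [this]
  have hq : (queryLaw N lam v α β).real {q} = lengthProb lam N q.1 *
      ∫ p, ∏ i : Fin q.1, trigramProb v (α i) (β i) p (q.2 i) ∂productLaw d := by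
    rw [queryLaw_real_apply N v β hl hα, ← integral_const_mul]
    congr with p
    rw [Finset.sum_eq_single q]
    · simp [queryProbGiven]
    · intro q' _ hq'
      simp [hq']
    · simp
  rw [queryProb, measureReal_def, cond_apply (measurableSet_query _),
    Set.inter_eq_right.2 (by simp), ENNReal.toReal_mul, ENNReal.toReal_inv]
  change ((queryLaw N lam v α β).real {q' | q'.1 = q.1})⁻¹ *
    (queryLaw N lam v α β).real {q} = _
  rw [hA, hq, inv_mul_cancel_left₀ hlen]

/-- The probability that a query contains a trigram from `S`, by a union bound over positions. -/
lemma queryLaw_exists_mem_le [NeZero d] [NeZero m] (hl : 0 < lam) (hα : ∀ i, 0 ≤ α i ∧ α i ≤ 1) (S : Set (Fin m)) :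
    (queryLaw N lam v α β).real {q | ∃ i, q.2 i ∈ S} ≤
      ∫ p, ∑ i ∈ Finset.range N, ∑ k, S.indicator (trigramProb v (α i) (β i) p) k
        ∂productLaw d := by
  classical
  have hP := fun (i : ℕ) (p : Product d) k => trigramProb_nonneg v (hα i) (β i) p k
  have hcont : ∀ (i : ℕ) k, Continuous fun p : Product d =>
      S.indicator (trigramProb v (α i) (β i) p) k := by
    intro i k
    by_cases hk : k ∈ S
    · simpa [hk] using continuous_trigramProb v (α i) (β i) k
    · simpa [hk] using continuous_const
  rw [queryLaw_real_apply N v β hl hα]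
  refine integral_mono_of_nonneg (Filter.Eventually.of_forall fun p => Finset.sum_nonneg fun q _ =>
    Set.indicator_nonneg (fun q _ => queryProbGiven_nonneg N v β hl hα p q) q) ?_
    (Filter.Eventually.of_forall fun p => ?_)
  · refine Continuous.integrable_of_hasCompactSupport ?_ (HasCompactSupport.of_compactSpace _)
    exact continuous_finsetSum _ fun i _ => continuous_finsetSum _ fun k _ => hcont i k
  · set T : ℕ → ℝ := fun i => ∑ k, S.indicator (trigramProb v (α i) (β i) p) k with hT
    have hT0 : ∀ i, 0 ≤ T i := fun i =>
      Finset.sum_nonneg fun k _ => Set.indicator_nonneg (fun k _ => hP i p k) k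
    have key : ∀ n : Fin (N + 1), ∑ t : Fin n → Fin m,
        ({q : Query m N | ∃ i, q.2 i ∈ S}).indicator (queryProbGiven N lam v α β p) ⟨n, t⟩ ≤
        lengthProb lam N n * ∑ i ∈ Finset.range N, T i := by
      intro n
      -- Union bound over the position `i` of a trigram in `S`. Putting the indicator into the
      -- `i`-th factor preserves the product structure.
      have h1 : ∀ t : Fin n → Fin m,
          ({q : Query m N | ∃ i, q.2 i ∈ S}).indicator (queryProbGiven N lam v α β p) ⟨n, t⟩ ≤
          ∑ i : Fin n, lengthProb lam N n * ∏ j : Fin n,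
            if j = i then S.indicator (trigramProb v (α j) (β j) p) (t j)
            else trigramProb v (α j) (β j) p (t j) := by
        intro t
        have hnn : ∀ i : Fin n, 0 ≤ lengthProb lam N n * ∏ j : Fin n,
            if j = i then S.indicator (trigramProb v (α j) (β j) p) (t j)
            else trigramProb v (α j) (β j) p (t j) := fun i =>
          mul_nonneg (lengthProb_pos hl N _).le (Finset.prod_nonneg fun j _ => by
            split_ifs
            · exact Set.indicator_nonneg (fun k _ => hP _ p k) _
            · exact hP _ p _)
        by_cases h : ∃ i, t i ∈ S
        · obtain ⟨i, hi⟩ := h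
          rw [Set.indicator_of_mem (show (⟨n, t⟩ : Query m N) ∈ {q : Query m N | ∃ i, q.2 i ∈ S}
            from ⟨i, hi⟩)]
          refine le_trans (le_of_eq ?_)
            (Finset.single_le_sum (fun i _ => hnn i) (Finset.mem_univ i))
          simp only [queryProbGiven]
          congr 1
          refine Finset.prod_congr rfl fun j _ => ?_
          split_ifs with hji
          · subst hji; simp [hi]
          · rfl
        · rw [Set.indicator_of_notMem (show (⟨n, t⟩ : Query m N) ∉ {q : Query m N | ∃ i, q.2 i ∈ S}
            from h)]
          exact Finset.sum_nonneg fun i _ => hnn i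
      refine (Finset.sum_le_sum fun t _ => h1 t).trans ?_
      rw [Finset.sum_comm]
      simp_rw [← Finset.mul_sum]
      refine mul_le_mul_of_nonneg_left ?_ (lengthProb_pos hl N _).le
      -- The sum over sequences factors over positions, and every position other than `i` sums to
      -- `1`.
      have h2 : ∀ i : Fin n, ∑ t : Fin n → Fin m, ∏ j : Fin n,
            (if j = i then S.indicator (trigramProb v (α j) (β j) p) (t j)
            else trigramProb v (α j) (β j) p (t j)) = T i := by
        intro i
        rw [← Fintype.prod_sum fun (j : Fin n) k =>
          if j = i then S.indicator (trigramProb v (α j) (β j) p) k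
            else trigramProb v (α j) (β j) p k, Finset.prod_eq_single i]
        · simp [hT]
        · intro j _ hj
          simp [hj, sum_trigramProb]
        · simp
      simp_rw [h2]
      rw [Fin.sum_univ_eq_sum_range T]
      exact Finset.sum_le_sum_of_subset_of_nonneg
        (Finset.range_subset_range.2 (Nat.lt_succ_iff.1 n.2)) fun i _ _ => hT0 i
    simp only [Fintype.sum_sigma]
    refine (Finset.sum_le_sum fun n _ => key n).trans ?_
    rw [← Finset.sum_mul, sum_lengthProb hl, one_mul]

end law

/-! ### From concentrated partition functions to query probabilities -/

/-- Telescoping, one factor at a time. Errors are measured against a majorant `w` of `y` because the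
uniform component creates an additive error, not controlled by `y`; the application takes `w = 1 +
y`. -/
lemma abs_prod_sub_prod_le {ι : Type*} (s : Finset ι) (h y w τ : ι → ℝ) {T : ℝ} (hT : 0 ≤ T)
    (hy : ∀ i ∈ s, 0 ≤ y i) (hyw : ∀ i ∈ s, y i ≤ w i) (hτ : ∀ i ∈ s, 0 ≤ τ i ∧ τ i ≤ T)
    (hh : ∀ i ∈ s, |h i - y i| ≤ τ i * w i) :
    |∏ i ∈ s, h i - ∏ i ∈ s, y i| ≤ (∑ i ∈ s, τ i) * (1 + T) ^ s.card * ∏ i ∈ s, w i := by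
  classical
  induction s using Finset.induction_on with
  | empty => simp
  | insert j s hj ih =>
    simp only [Finset.mem_insert, forall_eq_or_imp] at hy hyw hτ hh
    have ih' := ih hy.2 hyw.2 hτ.2 hh.2
    rw [Finset.prod_insert hj, Finset.prod_insert hj, Finset.prod_insert hj, Finset.sum_insert hj,
      Finset.card_insert_of_notMem hj]
    have hw : 0 ≤ w j := hy.1.trans hyw.1
    have hhj : |h j| ≤ (1 + T) * w j := by
      have h1 : |h j| ≤ |h j - y j| + |y j| := by simpa using abs_add_le (h j - y j) (y j)
      rw [abs_of_nonneg hy.1] at h1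
      have h2 : τ j * w j ≤ T * w j := mul_le_mul_of_nonneg_right hτ.1.2 hw
      linarith [hh.1, hyw.1]
    have hY0 : 0 ≤ ∏ i ∈ s, y i := Finset.prod_nonneg hy.2
    have hYW : ∏ i ∈ s, y i ≤ ∏ i ∈ s, w i := Finset.prod_le_prod hy.2 hyw.2
    have hW0 := hY0.trans hYW
    have hpow : 1 ≤ (1 + T) ^ (s.card + 1) := one_le_pow₀ (by linarith)
    have e : h j * ∏ i ∈ s, h i - y j * ∏ i ∈ s, y i =
        h j * (∏ i ∈ s, h i - ∏ i ∈ s, y i) + (h j - y j) * ∏ i ∈ s, y i := by ring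
    rw [e]
    refine (abs_add_le _ _).trans ?_
    rw [abs_mul, abs_mul, abs_of_nonneg hY0]
    have t1 : |h j| * |∏ i ∈ s, h i - ∏ i ∈ s, y i| ≤
        (1 + T) * w j * ((∑ i ∈ s, τ i) * (1 + T) ^ s.card * ∏ i ∈ s, w i) :=
      mul_le_mul hhj ih' (abs_nonneg _) (by positivity)
    have t2 : |h j - y j| * ∏ i ∈ s, y i ≤ τ j * w j * ∏ i ∈ s, w i :=
      mul_le_mul hh.1 hYW hY0 (mul_nonneg hτ.1.1 hw)
    have t3 : τ j * w j * ∏ i ∈ s, w i ≤ (τ j * w j * ∏ i ∈ s, w i) * (1 + T) ^ (s.card + 1) :=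
      le_mul_of_one_le_right (mul_nonneg (mul_nonneg hτ.1.1 hw) hW0) hpow
    refine (add_le_add t1 (t2.trans t3)).trans (le_of_eq ?_)
    rw [pow_succ]; ring

lemma integrable_of_continuous {d : ℕ} [NeZero d] {f : Product d → ℝ} (hf : Continuous f) :
    Integrable f (productLaw d) :=
  hf.integrable_of_hasCompactSupport (HasCompactSupport.of_compactSpace _)

lemma norm_sq_sum_div_le {d : ℕ} [NeZero d] {ι : Type*} (s : Finset ι) (u : ι → E d) {R : ℝ}
    {N : ℕ} (hs : s.card ≤ N) (hR : 0 ≤ R) (hu : ∀ i ∈ s, ‖u i‖ ≤ R * √d) :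
    ‖∑ i ∈ s, u i‖ ^ 2 / (2 * d) ≤ (N * R) ^ 2 / 2 := by
  have hd : (0 : ℝ) < d := Nat.cast_pos.2 (Nat.pos_of_ne_zero (NeZero.ne d))
  have h1 : ‖∑ i ∈ s, u i‖ ≤ N * (R * √d) := by
    refine (norm_sum_le_of_le s hu).trans ?_
    rw [Finset.sum_const, nsmul_eq_mul]
    gcongr
  have h2 : ‖∑ i ∈ s, u i‖ ^ 2 ≤ (N * (R * √d)) ^ 2 := pow_le_pow_left₀ (norm_nonneg _) h1 2
  rw [div_le_div_iff₀ (by positivity) (by positivity)]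
  have h3 : (N * (R * √d)) ^ 2 = (N * R) ^ 2 * d := by
    rw [← mul_assoc, mul_pow, Real.sq_sqrt hd.le]
  rw [h3] at h2
  linarith

/-- Expanding the product over subsets leaves at most `2 ^ N` spherical exponential averages, each
bounded independently of the dimension. -/
lemma integral_prod_one_add_exp_le {d : ℕ} [NeZero d] {ι : Type*} (s : Finset ι) (u : ι → E d)
    {R : ℝ} {N : ℕ} (hs : s.card ≤ N) (hR : 0 ≤ R) (hu : ∀ i ∈ s, ‖u i‖ ≤ R * √d) :
    ∫ p : Product d, ∏ i ∈ s, (1 + exp (inner ℝ (u i) (p : E d))) ∂productLaw d ≤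
      2 ^ N * exp ((N * R) ^ 2 / 2) := by
  classical
  have e : ∀ p : Product d, ∏ i ∈ s, (1 + exp (inner ℝ (u i) (p : E d))) =
      ∑ t ∈ s.powerset, exp (inner ℝ (∑ i ∈ t, u i) (p : E d)) := by
    intro p
    rw [Finset.prod_one_add]
    refine Finset.sum_congr rfl fun t _ => ?_
    rw [sum_inner, exp_sum]
  simp_rw [e]
  rw [integral_finsetSum _ fun t _ => integrable_of_continuous (by fun_prop)]
  calc _ ≤ ∑ t ∈ s.powerset, exp ((N * R) ^ 2 / 2) := by
        refine Finset.sum_le_sum fun t ht => (integral_exp_inner_productLaw_le _).trans ?_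
        have hts := Finset.mem_powerset.1 ht
        exact exp_le_exp.2 (norm_sq_sum_div_le t u ((Finset.card_le_card hts).trans hs) hR
          fun i hi => hu i (hts hi))
    _ ≤ _ := by
        rw [Finset.sum_const, Finset.card_powerset, nsmul_eq_mul]
        push_cast
        gcongr
        norm_num

/-- If the partition function is close to `z`, then the normalised trigram probability is close to its
exponential factor. -/
lemma abs_trigramProb_sub_le {d m : ℕ} [NeZero m] (v : Fin m → E d) {a b z ε K : ℝ}
    (ha : 1 / 2 < a ∧ a ≤ 1) (hz : 0 < z) (hzK : z ≤ K * m) (hε : 0 ≤ ε ∧ ε ≤ 1 / 2)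
    {p : Product d} (hp : (1 - ε) * z ≤ partitionFn v b p ∧ partitionFn v b p ≤ (1 + ε) * z)
    (k : Fin m) :
    |trigramProb v a b p k * (z / a) - exp (inner ℝ (b • v k) (p : E d))| ≤
      (2 * ε + 2 * K * (1 - a)) * (1 + exp (inner ℝ (b • v k) (p : E d))) := by
  have hZ := partitionFn_pos v b p
  have ha0 : 0 < a := by linarith [ha.1]
  have hm : (0 : ℝ) < m := Nat.cast_pos.2 (Nat.pos_of_ne_zero (NeZero.ne m))
  have hK : 0 < K := by
    by_contra h
    have : K * m ≤ 0 := mul_nonpos_of_nonpos_of_nonneg (not_lt.1 h) hm.le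
    linarith
  rw [real_inner_smul_left]
  set y := exp (b * inner ℝ (v k) (p : E d)) with hy
  have hy0 : 0 < y := exp_pos _
  -- The two sources of error: normalisation (multiplicative in `y`) and the uniform component
  -- (additive).
  have e : trigramProb v a b p k * (z / a) - y =
      y * ((z - partitionFn v b p) / partitionFn v b p) + z / m * (1 - a) / a := by
    unfold trigramProb
    rw [← hy]
    field_simp
    ring
  have h1 : |(z - partitionFn v b p) / partitionFn v b p| ≤ 2 * ε := by
    rw [abs_div, abs_of_pos hZ, div_le_iff₀ hZ]
    have h2 : |z - partitionFn v b p| ≤ ε * z := abs_le.2 ⟨by linarith [hp.2], by linarith [hp.1]⟩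
    have h3 : z ≤ 2 * partitionFn v b p := by
      have : (1 / 2) * z ≤ (1 - ε) * z := mul_le_mul_of_nonneg_right (by linarith [hε.2]) hz.le
      linarith [hp.1]
    have h4 := mul_le_mul_of_nonneg_left h3 hε.1
    linarith
  have h2 : |z / m * (1 - a) / a| ≤ 2 * K * (1 - a) := by
    have h1a : 0 ≤ 1 - a := by linarith [ha.2]
    rw [abs_of_nonneg (by positivity), div_le_iff₀ ha0]
    have hzm : z / m ≤ K := (div_le_iff₀ hm).2 hzK
    have h3 : z / m * (1 - a) ≤ K * (1 - a) := mul_le_mul_of_nonneg_right hzm h1a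
    have h4 : K * (1 - a) * 1 ≤ K * (1 - a) * (2 * a) :=
      mul_le_mul_of_nonneg_left (by linarith [ha.1]) (by positivity)
    linarith
  rw [e]
  refine (abs_add_le _ _).trans ?_
  rw [abs_mul, abs_of_pos hy0]
  have h3 := mul_le_mul_of_nonneg_left h1 hy0.le
  have h1a : 0 ≤ 1 - a := by linarith [ha.2]
  have h4 : 0 ≤ 2 * K * (1 - a) * y := by positivity
  have := hε.1
  linarith

/-- Cauchy–Schwarz in Young form: on `S`, `f ≤ 1 / (2 * √η) + √η / 2 * f ^ 2`. -/
lemma setIntegral_le_sqrt {d : ℕ} [NeZero d] {S : Set (Product d)} (hS : MeasurableSet S)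
    {η D : ℝ} (hη : 0 < η) (hSη : (productLaw d).real S ≤ η) {f : Product d → ℝ}
    (hf : Continuous f) (hD : ∫ p, f p ^ 2 ∂productLaw d ≤ D) :
    ∫ p, S.indicator f p ∂productLaw d ≤ √η * ((1 + D) / 2) := by
  have hs : 0 < √η := Real.sqrt_pos.2 hη
  have hpt : ∀ p, S.indicator f p ≤ (2 * √η)⁻¹ * S.indicator 1 p + √η / 2 * f p ^ 2 := by
    intro p
    by_cases hp : p ∈ S
    · simp only [hp, Set.indicator_of_mem, Pi.one_apply, mul_one]
      rw [← sub_nonneg]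
      have : (2 * √η)⁻¹ + √η / 2 * f p ^ 2 - f p = (1 - √η * f p) ^ 2 / (2 * √η) := by
        field_simp; ring
      rw [this]; positivity
    · simp only [hp, not_false_eq_true, Set.indicator_of_notMem, mul_zero, zero_add]
      positivity
  have hI1 : Integrable (fun p => (2 * √η)⁻¹ * S.indicator (1 : Product d → ℝ) p)
      (productLaw d) := ((integrable_const (1 : ℝ)).indicator hS).const_mul _
  have hI2 : Integrable (fun p => √η / 2 * f p ^ 2) (productLaw d) :=
    (integrable_of_continuous (by fun_prop)).const_mul _
  refine (integral_mono ((integrable_of_continuous hf).indicator hS) (hI1.add hI2) hpt).trans ?_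
  simp only [Pi.add_apply]
  rw [integral_add hI1 hI2, integral_const_mul, integral_const_mul, integral_indicator_one hS]
  have h1 : (2 * √η)⁻¹ * (productLaw d).real S ≤ (2 * √η)⁻¹ * η :=
    mul_le_mul_of_nonneg_left hSη (by positivity)
  have h2 : (2 * √η)⁻¹ * η = √η / 2 := by
    have := Real.mul_self_sqrt hη.le
    field_simp; linarith
  have h3 : √η / 2 * ∫ p, f p ^ 2 ∂productLaw d ≤ √η / 2 * D :=
    mul_le_mul_of_nonneg_left hD (by positivity)
  rw [h2] at h1
  linarith

/-- If the partition functions concentrate over the product, then the probability of a norm bounded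
query is close to its approximation. -/
lemma abs_queryProb_sub_approxProb_le {d m N : ℕ} [NeZero d] [NeZero m] {lam : ℝ} (hl : 0 < lam)
    (v : Fin m → E d) {α β Z : ℕ → ℝ} {B b K ε η : ℝ} (hα : ∀ i, 1 / 2 < α i ∧ α i ≤ 1)
    (hB : 0 ≤ B) (hβ : ∀ i, |β i| ≤ B) (hb : 0 ≤ b) (hK : 1 ≤ K)
    (hZ : ∀ i, 0 < Z i ∧ Z i ≤ K * m) (hε : 0 ≤ ε ∧ ε ≤ 1 / 2) (hη : 0 < η)
    (hbad : (productLaw d).real {p | ∃ i < N, ¬ ((1 - ε) * Z i ≤ partitionFn v (β i) p ∧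
      partitionFn v (β i) p ≤ (1 + ε) * Z i)} ≤ η)
    (q : Query m N) (hq : NormBounded b v q) :
    |queryProb N lam v α β q - approxProb v α β Z q| ≤
      ((2 * N * ε + 2 * K * ∑ i : Fin q.1, (1 - α i)) *
          ((2 + K) ^ N * (2 ^ N * exp ((N * (B * b)) ^ 2 / 2))) +
        η * (2 * K * m) ^ N + √η * ((1 + exp (4 * ((N * (B * b)) ^ 2 / 2))) / 2) +
        ((N * (B * b)) ^ 2 / 2) ^ 2 / d) * approxProb v α β Z q := by
  classical
  have hm : (1 : ℝ) ≤ m := Nat.one_le_cast.2 (Nat.one_le_iff_ne_zero.2 (NeZero.ne m))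
  have hd : (0 : ℝ) < d := Nat.cast_pos.2 (Nat.pos_of_ne_zero (NeZero.ne d))
  have hα' : ∀ i, 0 ≤ α i ∧ α i ≤ 1 := fun i => ⟨by linarith [(hα i).1], (hα i).2⟩
  have hα0 : ∀ i, 0 < α i := fun i => by linarith [(hα i).1]
  have hqN : (q.1 : ℕ) ≤ N := Nat.lt_succ_iff.1 q.1.2
  set M : ℝ := (N * (B * b)) ^ 2 / 2 with hM
  set u : Fin q.1 → E d := fun i => β i • v (q.2 i) with hu
  set V : E d := ∑ i, u i with hV
  set x : ℝ := ‖V‖ ^ 2 / (2 * d) with hx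
  set W : ℝ := ∏ i : Fin q.1, α i / Z i with hW
  set S : Set (Product d) := {p | ∃ i < N, ¬ ((1 - ε) * Z i ≤ partitionFn v (β i) p ∧
      partitionFn v (β i) p ≤ (1 + ε) * Z i)} with hS
  set A : ℝ := 2 * N * ε + 2 * K * ∑ i : Fin q.1, (1 - α i) with hA
  have hu' : ∀ i, ‖u i‖ ≤ B * b * √d := fun i => by
    rw [hu, norm_smul, Real.norm_eq_abs, mul_assoc]
    exact mul_le_mul (hβ i) (hq i) (norm_nonneg _) hB
  have hcard : (Finset.univ : Finset (Fin q.1)).card ≤ N := by simpa using hqN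
  have hxM : x ≤ M := norm_sq_sum_div_le Finset.univ u hcard (by positivity) fun i _ => hu' i
  have hx0 : 0 ≤ x := by positivity
  have hM0 : 0 ≤ M := hx0.trans hxM
  have hW0 : 0 < W := Finset.prod_pos fun i _ => div_pos (hα0 i) (hZ i).1
  have hA0 : 0 ≤ A := by
    have : 0 ≤ ∑ i : Fin q.1, (1 - α i) := Finset.sum_nonneg fun i _ => by linarith [(hα i).2]
    have := hε.1
    positivity
  have hSm : MeasurableSet S := by
    have : S = ⋃ i ∈ Finset.range N, {p : Product d | (1 - ε) * Z i ≤ partitionFn v (β i) p ∧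
      partitionFn v (β i) p ≤ (1 + ε) * Z i}ᶜ := by
      ext p; simp [hS]
    rw [this]
    refine Finset.measurableSet_biUnion _ fun i _ => MeasurableSet.compl ?_
    have hc := (continuous_partitionFn v (β i)).measurable
    exact (measurableSet_le measurable_const hc).inter (measurableSet_le hc measurable_const)
  set e : Product d → ℝ := fun p => exp (inner ℝ V (p : E d)) with he
  have hec : Continuous e := by fun_prop
  set R : Product d → ℝ := fun p => ∏ i : Fin q.1, trigramProb v (α i) (β i) p (q.2 i) with hR
  have hRc : Continuous R := continuous_finsetProd _ fun i _ => continuous_trigramProb v _ _ _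
  have hR0 : ∀ p, 0 ≤ R p := fun p => Finset.prod_nonneg fun i _ => trigramProb_nonneg v (hα' _) _ _ _
  have hR1 : ∀ p, R p ≤ 1 := fun p => Finset.prod_le_one
    (fun i _ => trigramProb_nonneg v (hα' _) _ _ _) fun i _ => trigramProb_le_one v (hα' _) _ _ _
  set w : Product d → ℝ := fun p => ∏ i : Fin q.1, (1 + exp (inner ℝ (u i) (p : E d))) with hw
  have hwc : Continuous w := by fun_prop
  have hw0 : ∀ p, 0 ≤ w p := fun p => Finset.prod_nonneg fun i _ => by positivity
  -- pointwise comparison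
  have hpt : ∀ p, |R p - W * e p| ≤
      W * (A * (2 + K) ^ N) * w p + S.indicator 1 p + W * S.indicator e p := by
    intro p
    -- On the exceptional set only `R ≤ 1` and the size of `W * e` are used; off it all factors are
    -- compared.
    by_cases hp : p ∈ S
    · simp only [hp, Set.indicator_of_mem, Pi.one_apply]
      have h1 : 0 ≤ W * (A * (2 + K) ^ N) * w p := by have := hw0 p; positivity
      have h2 : 0 ≤ W * e p := by positivity
      rw [abs_le]
      constructor <;> linarith [hR0 p, hR1 p]
    · have hp' : ∀ i < N, (1 - ε) * Z i ≤ partitionFn v (β i) p ∧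
          partitionFn v (β i) p ≤ (1 + ε) * Z i := by
        intro i hi
        by_contra h
        exact hp ⟨i, hi, h⟩
      simp only [hp, not_false_eq_true, Set.indicator_of_notMem, mul_zero, add_zero]
      have hRW : R p = W * ∏ i : Fin q.1,
          (trigramProb v (α i) (β i) p (q.2 i) * (Z i / α i)) := by
        rw [hW, ← Finset.prod_mul_distrib]
        refine Finset.prod_congr rfl fun i _ => ?_
        have h1 := (hα0 i).ne'
        have h2 := (hZ i).1.ne'
        field_simp
      have heW : e p = ∏ i : Fin q.1, exp (inner ℝ (u i) (p : E d)) := by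
        rw [he, ← exp_sum, hV, ← sum_inner]
      rw [hRW, heW, ← mul_sub, abs_mul, abs_of_pos hW0, mul_assoc]
      refine mul_le_mul_of_nonneg_left ?_ hW0.le
      -- Since `ε ≤ 1 / 2` and `1 - α i ≤ 1 / 2`, each error coefficient is at most `1 + K`.
      refine (abs_prod_sub_prod_le Finset.univ _ _ (fun i => 1 + exp (inner ℝ (u i) (p : E d)))
        (fun i => 2 * ε + 2 * K * (1 - α i)) (T := 1 + K) (by linarith)
        (fun i _ => (exp_pos _).le) (fun i _ => by linarith) (fun i _ => ?_) (fun i _ => ?_)).trans ?_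
      · have h1 : 0 ≤ 1 - α i := by linarith [(hα i).2]
        have h2 : K * (1 - α i) ≤ K * (1 / 2) :=
          mul_le_mul_of_nonneg_left (by linarith [(hα i).1]) (by linarith)
        have h3 : 0 ≤ K * (1 - α i) := by positivity
        constructor
        · linarith [hε.1]
        · linarith [hε.2]
      · exact abs_trigramProb_sub_le v (hα i) (hZ i).1 (hZ i).2 hε
          (hp' i (i.2.trans_le hqN)) (q.2 i)
      · refine mul_le_mul_of_nonneg_right ?_ (hw0 p)
        refine mul_le_mul ?_ ?_ (by positivity) hA0
        · rw [Finset.sum_add_distrib, ← Finset.mul_sum, ← Finset.mul_sum, hA]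
          simp only [Finset.sum_const, nsmul_eq_mul, Finset.card_univ, Fintype.card_fin]
          have : (q.1 : ℝ) * (2 * ε) ≤ N * (2 * ε) :=
            mul_le_mul_of_nonneg_right (Nat.cast_le.2 hqN) (by linarith [hε.1])
          linarith
        · rw [show 1 + (1 + K) = 2 + K by ring]
          exact pow_le_pow_right₀ (by linarith) hcard
  -- integration
  have hI1 : Integrable (fun p => W * (A * (2 + K) ^ N) * w p) (productLaw d) :=
    (integrable_of_continuous hwc).const_mul _
  have hI2 : Integrable (S.indicator (1 : Product d → ℝ)) (productLaw d) :=
    (integrable_const (1 : ℝ)).indicator hSm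
  have hI3 : Integrable (fun p => W * S.indicator e p) (productLaw d) :=
    ((integrable_of_continuous hec).indicator hSm).const_mul _
  have hmain : |∫ p, R p ∂productLaw d - W * ∫ p, e p ∂productLaw d| ≤
      W * (A * (2 + K) ^ N) * (2 ^ N * exp M) + η + W * (√η * ((1 + exp (4 * M)) / 2)) := by
    rw [← integral_const_mul, ← integral_sub (integrable_of_continuous hRc)
      ((integrable_of_continuous hec).const_mul _)]
    refine (abs_integral_le_integral_abs).trans ?_
    refine (integral_mono (integrable_of_continuous (by fun_prop)) ((hI1.add hI2).add hI3)
      hpt).trans ?_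
    have hsum : ∫ p, (W * (A * (2 + K) ^ N) * w p + S.indicator 1 p + W * S.indicator e p)
        ∂productLaw d = ∫ p, W * (A * (2 + K) ^ N) * w p ∂productLaw d +
          ∫ p, S.indicator 1 p ∂productLaw d + ∫ p, W * S.indicator e p ∂productLaw d := by
      rw [← integral_add hI1 hI2]
      exact integral_add (hI1.add hI2) hI3
    refine (le_of_eq hsum).trans ?_
    rw [integral_const_mul, integral_const_mul,
      integral_indicator_one hSm]
    refine add_le_add (add_le_add (mul_le_mul_of_nonneg_left ?_ (by positivity)) hbad)
      (mul_le_mul_of_nonneg_left ?_ hW0.le)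
    · exact integral_prod_one_add_exp_le Finset.univ u hcard (by positivity) fun i _ => hu' i
    · refine setIntegral_le_sqrt hSm hη hbad hec ?_
      -- The square is the exponential for `2 • V`, so the second moment is at most `exp (4 * x)`.
      have : ∀ p, e p ^ 2 = exp (inner ℝ ((2 : ℝ) • V) (p : E d)) := by
        intro p
        rw [real_inner_smul_left, he, ← exp_nat_mul]
        norm_num
      simp_rw [this]
      refine (integral_exp_inner_productLaw_le _).trans (exp_le_exp.2 ?_)
      rw [norm_smul, mul_pow, Real.norm_eq_abs, sq_abs, mul_div_assoc, ← hx]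
      linarith
  -- Since `α i / Z i ≥ 1 / (2 * K * m)`, the additive error `η` becomes a relative one at the price
  -- of `m ^ N`.
  have hWlow : 1 ≤ (2 * K * m) ^ N * W := by
    have h1 : ∀ i : Fin q.1, (2 * K * m)⁻¹ ≤ α i / Z i := by
      intro i
      rw [inv_eq_one_div, div_le_div_iff₀ (by positivity) (hZ i).1]
      have h2 : (1 / 2) * (2 * K * m) ≤ α i * (2 * K * m) :=
        mul_le_mul_of_nonneg_right (hα i).1.le (by positivity)
      linarith [(hZ i).2]
    have h2 : ((2 * K * m)⁻¹) ^ (q.1 : ℕ) ≤ W := by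
      have := Finset.prod_le_prod (s := Finset.univ) (fun (i : Fin q.1) _ =>
        (by positivity : (0 : ℝ) ≤ (2 * K * m)⁻¹)) fun i _ => h1 i
      rwa [Finset.prod_const, Finset.card_univ, Fintype.card_fin] at this
    have hKm : 1 ≤ 2 * K * m := by nlinarith
    have h3 : ((2 * K * m)⁻¹) ^ N ≤ W :=
      (pow_le_pow_of_le_one (by positivity) (inv_le_one_of_one_le₀ hKm) hqN).trans h2
    rw [inv_pow] at h3
    calc (1 : ℝ) = (2 * K * m) ^ N * ((2 * K * m) ^ N)⁻¹ := (mul_inv_cancel₀ (by positivity)).symm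
      _ ≤ _ := mul_le_mul_of_nonneg_left h3 (by positivity)
  have hex : |W * ∫ p, e p ∂productLaw d - W * exp x| ≤ W * (exp x * (M ^ 2 / d)) := by
    rw [← mul_sub, abs_mul, abs_of_pos hW0]
    refine mul_le_mul_of_nonneg_left ?_ hW0.le
    have h1 := integral_exp_inner_productLaw_le V
    have h2 := le_integral_exp_inner_productLaw V
    rw [← hx] at h1 h2
    have h3 : exp x * (x ^ 2 / d) ≤ exp x * (M ^ 2 / d) := by gcongr
    have h4 : 0 ≤ exp x * (M ^ 2 / d) := by positivity
    rw [abs_le]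
    constructor
    · have : exp x * (1 - x ^ 2 / d) = exp x - exp x * (x ^ 2 / d) := by ring
      linarith
    · linarith
  have happ : approxProb v α β Z q = W * exp x := rfl
  rw [queryProb_eq N v β hl hα', happ]
  -- Errors relative to `W` are also errors relative to `W * exp x`.
  have hex1 : 1 ≤ exp x := one_le_exp hx0
  have t := abs_sub_le (∫ p, R p ∂productLaw d) (W * ∫ p, e p ∂productLaw d) (W * exp x)
  refine t.trans ((add_le_add hmain hex).trans ?_)
  have hη1 : η ≤ W * (η * (2 * K * m) ^ N) := by
    have := mul_le_mul_of_nonneg_left hWlow hη.le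
    linarith
  have hG : 0 ≤ A * ((2 + K) ^ N * (2 ^ N * exp M)) + η * (2 * K * m) ^ N +
      √η * ((1 + exp (4 * M)) / 2) := by positivity
  have hG' := mul_le_mul_of_nonneg_left hex1 (mul_nonneg hW0.le hG)
  linarith

/-! ### Concentration of the partition function for a fixed product -/

/-- No lower bound on `y` is needed, since `y + y ^ 2 ≥ 0` for `y ≤ -1`. Hence a Chernoff bound
needs only variables bounded above. -/
lemma exp_le_one_add_add_sq {y : ℝ} (hy : y ≤ 1) : exp y ≤ 1 + y + y ^ 2 := by
  by_cases h : -1 ≤ y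
  · have := (abs_le.1 (Real.abs_exp_sub_one_sub_id_le (abs_le.2 ⟨h, hy⟩))).2
    linarith
  · have h1 : exp y ≤ 1 := exp_le_one_iff.2 (by linarith)
    nlinarith

/-- A Chernoff bound for sums of independent variables that are bounded above and have bounded second
moments. -/
lemma chernoff_of_le {Ω ι : Type*} [Fintype ι] [MeasurableSpace Ω] (μ : Measure Ω)
    [IsProbabilityMeasure μ] (f : ι → Ω → ℝ) (hf : ∀ k, Measurable (f k)) {θ t D : ℝ} {a : ι → ℝ}
    (hθ : 0 ≤ θ) (hθf : ∀ k x, θ * f k x ≤ 1) (hint : ∀ k, Integrable (f k) μ)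
    (hint2 : ∀ k, Integrable (fun x => f k x ^ 2) μ) (ha : ∀ k, ∫ x, f k x ∂μ ≤ a k)
    (hD : ∀ k, ∫ x, f k x ^ 2 ∂μ ≤ D) :
    (Measure.pi fun _ : ι => μ).real {g | ∑ k, a k + t ≤ ∑ k, f k (g k)} ≤
      exp (-θ * t + θ ^ 2 * (Fintype.card ι * D)) := by
  have hexpI : ∀ k, Integrable (fun x => exp (θ * f k x)) μ := fun k =>
    Integrable.of_bound (by have := hf k; fun_prop) (exp 1)
      (Filter.Eventually.of_forall fun x => by
        rw [Real.norm_eq_abs, abs_of_pos (exp_pos _)]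
        exact exp_le_exp.2 (hθf k x))
  have hmgf : ∀ k, ∫ x, exp (θ * f k x) ∂μ ≤ exp (θ * a k + θ ^ 2 * D) := by
    intro k
    have hI : Integrable (fun x => 1 + θ * f k x) μ :=
      (integrable_const _).add ((hint k).const_mul _)
    have hI2 : Integrable (fun x => θ ^ 2 * f k x ^ 2) μ := (hint2 k).const_mul _
    calc ∫ x, exp (θ * f k x) ∂μ ≤ ∫ x, (1 + θ * f k x) + θ ^ 2 * f k x ^ 2 ∂μ := by
          refine integral_mono (hexpI k) (hI.add hI2) fun x => ?_
          have := exp_le_one_add_add_sq (hθf k x)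
          rwa [mul_pow] at this
      _ = 1 + θ * ∫ x, f k x ∂μ + θ ^ 2 * ∫ x, f k x ^ 2 ∂μ := by
          rw [integral_add hI hI2, integral_add (integrable_const _) ((hint k).const_mul _),
            integral_const_mul, integral_const_mul]
          simp
      _ ≤ 1 + (θ * a k + θ ^ 2 * D) := by
          have h1 := mul_le_mul_of_nonneg_left (ha k) hθ
          have h2 := mul_le_mul_of_nonneg_left (hD k) (sq_nonneg θ)
          linarith
      _ ≤ _ := by linarith [add_one_le_exp (θ * a k + θ ^ 2 * D)]
  have hprod : ∫ g, ∏ k, exp (θ * f k (g k)) ∂(Measure.pi fun _ : ι => μ) =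
      ∏ k, ∫ x, exp (θ * f k x) ∂μ :=
    integral_fintype_prod_eq_prod (f := fun k x => exp (θ * f k x))
  have hprodI : Integrable (fun g : ι → Ω => ∏ k, exp (θ * f k (g k)))
      (Measure.pi fun _ : ι => μ) :=
    Integrable.fintype_prod (f := fun k x => exp (θ * f k x)) hexpI
  have hM := mul_meas_ge_le_integral_of_nonneg (μ := Measure.pi fun _ : ι => μ)
    (Filter.Eventually.of_forall fun g =>
      Finset.prod_nonneg fun k _ => (exp_pos (θ * f k (g k))).le) hprodI
    (exp (θ * (∑ k, a k + t)))
  have hsub : (Measure.pi fun _ : ι => μ).real {g | ∑ k, a k + t ≤ ∑ k, f k (g k)} ≤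
      (Measure.pi fun _ : ι => μ).real
        {g | exp (θ * (∑ k, a k + t)) ≤ ∏ k, exp (θ * f k (g k))} := by
    refine measureReal_mono fun g hg => ?_
    have hg' : ∑ k, a k + t ≤ ∑ k, f k (g k) := hg
    rw [Set.mem_ofPred_eq]
    rw [← exp_sum, ← Finset.mul_sum]
    exact exp_le_exp.2 (mul_le_mul_of_nonneg_left hg' hθ)
  refine hsub.trans ?_
  rw [← mul_le_mul_iff_right₀ (exp_pos (θ * (∑ k, a k + t)))]
  refine hM.trans ?_
  rw [hprod, ← exp_add]
  refine (Finset.prod_le_prod (fun k _ => integral_nonneg fun x => (exp_pos _).le)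
    fun k _ => hmgf k).trans (le_of_eq ?_)
  rw [← exp_sum, Finset.sum_add_distrib, ← Finset.mul_sum]
  simp only [Finset.sum_const, nsmul_eq_mul, Finset.card_univ]
  ring_nf

/-- Two-sided concentration for sums of independent nonnegative variables, by truncation at `L`. -/
lemma sum_nonneg_concentration {Ω ι : Type*} [Fintype ι] [MeasurableSpace Ω] (μ : Measure Ω)
    [IsProbabilityMeasure μ] (X : ι → Ω → ℝ) (hX : ∀ k, Measurable (X k)) (hX0 : ∀ k x, 0 ≤ X k x)
    {θ t D L η : ℝ} (hθ : 0 ≤ θ) (hθL : θ * L ≤ 1) (hint : ∀ k, Integrable (X k) μ)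
    (hint2 : ∀ k, Integrable (fun x => X k x ^ 2) μ) (hD : ∀ k, ∫ x, X k x ^ 2 ∂μ ≤ D)
    (hL : ∀ k, μ.real {x | L < X k x} ≤ η) :
    (Measure.pi fun _ : ι => μ).real
        {g | t ≤ |∑ k, X k (g k) - ∑ k, ∫ x, X k x ∂μ|} ≤
      2 * exp (-θ * t + θ ^ 2 * (Fintype.card ι * D)) + Fintype.card ι * η := by
  set P := Measure.pi fun _ : ι => μ with hP
  -- The lower tail needs no truncation: `-X k` is bounded above by `0`.
  have hlow := chernoff_of_le μ (fun k x => -X k x) (fun k => (hX k).neg) (t := t) (D := D)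
    (a := fun k => -∫ x, X k x ∂μ) hθ
    (fun k x => by have := mul_nonneg hθ (hX0 k x); linarith) (fun k => (hint k).neg)
    (fun k => by simpa using hint2 k) (fun k => by rw [integral_neg])
    (fun k => by simpa using hD k)
  have hLm : ∀ k, MeasurableSet {x | X k x ≤ L} := fun k => measurableSet_le (hX k) measurable_const
  set f : ι → Ω → ℝ := fun k => {x | X k x ≤ L}.indicator (X k) with hf
  have hfX : ∀ k x, f k x ≤ X k x := fun k x => Set.indicator_le_self' (fun _ _ => hX0 k _) x
  have hf0 : ∀ k x, 0 ≤ f k x := fun k x => Set.indicator_nonneg (fun _ _ => hX0 k _) x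
  have hfm : ∀ k, Measurable (f k) := fun k => (hX k).indicator (hLm k)
  have hf2 : ∀ k, Integrable (fun x => f k x ^ 2) μ := fun k =>
    (hint2 k).mono' ((hfm k).pow_const 2).aestronglyMeasurable
      (Filter.Eventually.of_forall fun x => by
        rw [Real.norm_eq_abs, abs_of_nonneg (sq_nonneg _)]
        exact pow_le_pow_left₀ (hf0 k x) (hfX k x) 2)
  -- Truncation only lowers the means, so the untruncated means remain valid upper bounds.
  have hup := chernoff_of_le μ f hfm (t := t) (D := D) (a := fun k => ∫ x, X k x ∂μ) hθ
    (fun k x => by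
      by_cases hx : X k x ≤ L
      · have : f k x = X k x := Set.indicator_of_mem (s := {x | X k x ≤ L}) hx _
        rw [this]
        exact (mul_le_mul_of_nonneg_left hx hθ).trans hθL
      · have : f k x = 0 := Set.indicator_of_notMem (s := {x | X k x ≤ L}) hx _
        rw [this, mul_zero]; norm_num)
    (fun k => (hint k).indicator (hLm k)) hf2
    (fun k => integral_mono ((hint k).indicator (hLm k)) (hint k) (hfX k))
    (fun k => (integral_mono (hf2 k) (hint2 k) fun x =>
      pow_le_pow_left₀ (hf0 k x) (hfX k x) 2).trans (hD k))
  have htail : P.real (⋃ k, {g | L < X k (g k)}) ≤ Fintype.card ι * η := by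
    refine (measureReal_iUnion_fintype_le _).trans ?_
    calc _ ≤ ∑ _k : ι, η := by
          refine Finset.sum_le_sum fun k _ => le_trans (le_of_eq ?_) (hL k)
          have := (measurePreserving_eval (fun _ : ι => μ) k).measureReal_preimage
            (measurableSet_lt measurable_const (hX k)).nullMeasurableSet (s := {x | L < X k x})
          exact this
      _ = _ := by simp
  have hsub : {g : ι → Ω | t ≤ |∑ k, X k (g k) - ∑ k, ∫ x, X k x ∂μ|} ⊆
      ({g | ∑ k, -∫ x, X k x ∂μ + t ≤ ∑ k, -X k (g k)} ∪
        {g | ∑ k, ∫ x, X k x ∂μ + t ≤ ∑ k, f k (g k)}) ∪ ⋃ k, {g | L < X k (g k)} := by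
    intro g hg
    by_cases h : ∃ k, L < X k (g k)
    · exact Or.inr (Set.mem_iUnion.2 h)
    · have hfe : ∀ k, f k (g k) = X k (g k) := fun k =>
        Set.indicator_of_mem (s := {x | X k x ≤ L}) (not_lt.1 fun hk => h ⟨k, hk⟩) _
      left
      rcases le_abs.1 (Set.mem_ofPred_eq ▸ hg) with h1 | h1
      · right
        rw [Set.mem_ofPred_eq]
        simp_rw [hfe]
        linarith
      · left
        rw [Set.mem_ofPred_eq]
        rw [Finset.sum_neg_distrib, Finset.sum_neg_distrib]
        linarith
  refine (measureReal_mono hsub).trans ((measureReal_union_le _ _).trans ?_)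
  have := measureReal_union_le (μ := P) {g | ∑ k, -∫ x, X k x ∂μ + t ≤ ∑ k, -X k (g k)}
    {g | ∑ k, ∫ x, X k x ∂μ + t ≤ ∑ k, f k (g k)}
  linarith

/-- The expectation of the partition function. -/
def meanPartitionFn {m : ℕ} (s : Fin m → ℝ) (b : ℝ) : ℝ := ∑ k, exp ((b * s k) ^ 2 / 2)

lemma le_meanPartitionFn {m : ℕ} (s : Fin m → ℝ) (b : ℝ) : (m : ℝ) ≤ meanPartitionFn s b := by
  calc (m : ℝ) = ∑ _k : Fin m, (1 : ℝ) := by simp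
    _ ≤ _ := Finset.sum_le_sum fun k _ => one_le_exp (by positivity)

lemma meanPartitionFn_le {m : ℕ} {s : Fin m → ℝ} {b A : ℝ} (hA : ∀ k, |b * s k| ≤ A) :
    meanPartitionFn s b ≤ exp (A ^ 2 / 2) * m := by
  calc meanPartitionFn s b ≤ ∑ _k : Fin m, exp (A ^ 2 / 2) := by
        refine Finset.sum_le_sum fun k _ => exp_le_exp.2 ?_
        have : (b * s k) ^ 2 ≤ A ^ 2 := by
          rw [← sq_abs]; exact pow_le_pow_left₀ (abs_nonneg _) (hA k) 2
        linarith
    _ = _ := by simp [mul_comm]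

/-- As a linear functional of `g k`, the exponent has coefficient vector of norm `|b * s k|`,
whatever the unit vector `p`. -/
lemma mul_inner_trigramVectors {d m : ℕ} (s : Fin m → ℝ) (b : ℝ) (g : Fin m → E d) (p : Product d)
    (k : Fin m) : b * inner ℝ (trigramVectors s g k) (p : E d) =
      inner ℝ ((b * s k) • (p : E d)) (g k) := by
  rw [trigramVectors, real_inner_smul_left, real_inner_smul_left, real_inner_comm]
  ring

lemma norm_smul_product_sq {d : ℕ} (c : ℝ) (p : Product d) : ‖c • (p : E d)‖ ^ 2 = c ^ 2 := by
  rw [norm_smul, norm_eq_of_mem_sphere p, mul_one, Real.norm_eq_abs, sq_abs]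

lemma exp_inner_pow {d : ℕ} (a x : E d) (n : ℕ) :
    exp (inner ℝ a x) ^ n = exp (inner ℝ ((n : ℝ) • a) x) := by
  rw [real_inner_smul_left, exp_nat_mul]

/-- The upper tail of a lognormal variable. -/
lemma stdGaussian_exp_inner_tail {d : ℕ} (a : E d) {A L : ℝ} (hA : 0 < A) (ha : ‖a‖ ≤ A)
    (hL : 1 ≤ L) : (stdGaussian (E d)).real {x | L < exp (inner ℝ a x)} ≤
      exp (-(log L) ^ 2 / (2 * A ^ 2)) := by
  have hL0 : 0 < L := by linarith
  have hlog : 0 ≤ log L := log_nonneg hL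
  -- The optimal Chernoff parameter for a centred Gaussian of variance `A ^ 2` at level `log L`.
  set u : ℝ := log L / A ^ 2 with hu
  have hu0 : 0 ≤ u := by positivity
  have hM := mul_meas_ge_le_integral_of_nonneg (μ := stdGaussian (E d))
    (Filter.Eventually.of_forall fun x => (exp_pos (inner ℝ (u • a) x)).le)
    (integrable_exp_inner_stdGaussian (u • a)) (exp (u * log L))
  rw [integral_exp_inner_stdGaussian] at hM
  have hsub : (stdGaussian (E d)).real {x | L < exp (inner ℝ a x)} ≤
      (stdGaussian (E d)).real {x | exp (u * log L) ≤ exp (inner ℝ (u • a) x)} := by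
    refine measureReal_mono fun x hx => ?_
    have hx' : log L < inner ℝ a x := (log_lt_iff_lt_exp hL0).2 hx
    rw [Set.mem_ofPred_eq]
    rw [real_inner_smul_left]
    exact exp_le_exp.2 (mul_le_mul_of_nonneg_left hx'.le hu0)
  refine hsub.trans ?_
  rw [← mul_le_mul_iff_right₀ (exp_pos (u * log L))]
  refine hM.trans ?_
  rw [← exp_add, exp_le_exp, norm_smul, mul_pow, Real.norm_eq_abs, sq_abs]
  have h1 : ‖a‖ ^ 2 ≤ A ^ 2 := pow_le_pow_left₀ (norm_nonneg _) ha 2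
  calc u ^ 2 * ‖a‖ ^ 2 / 2 ≤ u ^ 2 * A ^ 2 / 2 := by gcongr
    _ = u * log L + -(log L) ^ 2 / (2 * A ^ 2) := by rw [hu]; field_simp; ring

/-- For a fixed product, the partition function concentrates around its mean. -/
lemma partitionFn_concentration {d m : ℕ} [NeZero m] (s : Fin m → ℝ) {b A : ℝ} (hA : 0 < A)
    (hs : ∀ k, |b * s k| ≤ A) (p : Product d) :
    (gaussianLaw d m).real {g | ¬ (
        (1 - epsZ (exp (2 * A ^ 2)) m) * meanPartitionFn s b ≤
          partitionFn (trigramVectors s g) b p ∧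
        partitionFn (trigramVectors s g) b p ≤
          (1 + epsZ (exp (2 * A ^ 2)) m) * meanPartitionFn s b)} ≤
      (2 + exp (16 * A ^ 2)) * exp (-(min (3 / 16) (1 / (64 * A ^ 2))) * log m ^ 2) := by
  have hm : (1 : ℝ) ≤ m := Nat.one_le_cast.2 (Nat.one_le_iff_ne_zero.2 (NeZero.ne m))
  have hm0 : (0 : ℝ) < m := by linarith
  set y := log m with hy
  have hy0 : 0 ≤ y := log_nonneg hm
  set D : ℝ := exp (2 * A ^ 2) with hD
  have hD1 : 1 ≤ D := one_le_exp (by positivity)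
  set a : Fin m → E d := fun k => (b * s k) • (p : E d) with ha
  have ha2 : ∀ k, ‖a k‖ ^ 2 = (b * s k) ^ 2 := fun k => norm_smul_product_sq _ p
  have haA : ∀ k, ‖a k‖ ≤ A := fun k => by
    rw [ha, norm_smul, norm_eq_of_mem_sphere p, mul_one]; exact hs k
  have hsm : 0 < √(m : ℝ) := Real.sqrt_pos.2 hm0
  have hsq : √(m : ℝ) ^ 2 = m := Real.sq_sqrt hm0.le
  -- This level balances two demands: `log m ≤ 4 * L` and `L ^ 2 = √m` give `θ * L ≤ 1` for `θ = log
  -- m / (4 * √m)`, while `log L` is still proportional to `log m`, so the truncation tail is `exp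
  -- (-c * log m ^ 2)`.
  set L : ℝ := (m : ℝ) ^ (1 / 4 : ℝ) with hL
  have hL1 : 1 ≤ L := one_le_rpow hm (by norm_num)
  have hlogL : log L = y / 4 := by rw [hL, log_rpow hm0]; ring
  have hyL : y ≤ 4 * L := by
    have := log_le_rpow_div hm0.le (show (0 : ℝ) < 1 / 4 by norm_num)
    rw [hy, hL]; linarith
  have hLsq : L * L = √(m : ℝ) := by
    rw [hL, ← rpow_add hm0, sqrt_eq_rpow]; norm_num
  have hθL : y / (4 * √m) * L ≤ 1 := by
    rw [div_mul_eq_mul_div, div_le_one (by positivity), ← hLsq]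
    nlinarith
  have hX1 : ∀ k, ∫ x, exp (inner ℝ (a k) x) ∂stdGaussian (E d) = exp ((b * s k) ^ 2 / 2) :=
    fun k => by rw [integral_exp_inner_stdGaussian, ha2]
  have hconc := sum_nonneg_concentration (stdGaussian (E d)) (fun k x => exp (inner ℝ (a k) x))
    (fun k => by fun_prop) (fun k x => (exp_pos _).le) (θ := y / (4 * √m)) (t := D * (y * √m))
    (D := D) (L := L) (η := exp (-(log L) ^ 2 / (2 * A ^ 2))) (by positivity) hθL
    (fun k => integrable_exp_inner_stdGaussian _)
    (fun k => by simp_rw [exp_inner_pow]; exact integrable_exp_inner_stdGaussian _)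
    (fun k => by
      simp_rw [exp_inner_pow]
      rw [integral_exp_inner_stdGaussian, norm_smul, mul_pow, ha2, hD, exp_le_exp]
      have : (b * s k) ^ 2 ≤ A ^ 2 := by
        rw [← sq_abs]; exact pow_le_pow_left₀ (abs_nonneg _) (hs k) 2
      norm_num
      linarith)
    (fun k => stdGaussian_exp_inner_tail (a k) hA (haA k) hL1)
  have hsub : {g : Fin m → E d | ¬ ((1 - epsZ D m) * meanPartitionFn s b ≤
          partitionFn (trigramVectors s g) b p ∧
        partitionFn (trigramVectors s g) b p ≤ (1 + epsZ D m) * meanPartitionFn s b)} ⊆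
      {g | D * (y * √m) ≤ |∑ k, exp (inner ℝ (a k) (g k)) -
        ∑ k, ∫ x, exp (inner ℝ (a k) x) ∂stdGaussian (E d)|} := by
    intro g hg
    have hpf : partitionFn (trigramVectors s g) b p = ∑ k, exp (inner ℝ (a k) (g k)) := by
      simp only [partitionFn, mul_inner_trigramVectors, ha]
    rw [Set.mem_ofPred_eq]
    simp_rw [hX1]
    rw [← hpf, ← meanPartitionFn]
    have hεZ : D * (y * √m) ≤ epsZ D m * meanPartitionFn s b := by
      have h1 : D * (y * √m) = epsZ D m * m := by
        rw [epsZ, ← hy]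
        field_simp
        rw [hsq]
      rw [h1]
      refine mul_le_mul_of_nonneg_left (le_meanPartitionFn s b) ?_
      unfold epsZ; positivity
    by_contra hlt
    have hlt' := abs_lt.1 (not_le.1 hlt)
    exact hg ⟨by linarith [hlt'.1], by linarith [hlt'.2]⟩
  refine (measureReal_mono hsub).trans (hconc.trans ?_)
  rw [Fintype.card_fin, hlogL]
  set c := min (3 / 16) (1 / (64 * A ^ 2)) with hc
  have e1 : exp (-(y / (4 * √m)) * (D * (y * √m)) + (y / (4 * √m)) ^ 2 * (m * D)) ≤
      exp (-c * y ^ 2) := by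
    rw [exp_le_exp]
    -- The exponent is `(-1/4 + 1/16) * D * y ^ 2`, the origin of `3 / 16`.
    have : -(y / (4 * √m)) * (D * (y * √m)) + (y / (4 * √m)) ^ 2 * (m * D) =
        -(3 / 16) * D * y ^ 2 := by
      rw [div_pow, mul_pow, hsq]
      field_simp
      ring
    rw [this]
    have h1 : c ≤ 3 / 16 := min_le_left _ _
    have h2 : c * y ^ 2 ≤ 3 / 16 * D * y ^ 2 :=
      mul_le_mul_of_nonneg_right (by linarith) (sq_nonneg y)
    linarith
  -- The union bound factor `m = exp y` is absorbed by half of the decay `y ^ 2 / (32 * A ^ 2)`, by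
  -- completing a square.
  have e2 : (m : ℝ) * exp (-(y / 4) ^ 2 / (2 * A ^ 2)) ≤ exp (16 * A ^ 2) * exp (-c * y ^ 2) := by
    nth_rewrite 1 [← exp_log hm0]
    rw [← hy, ← exp_add, ← exp_add, exp_le_exp]
    have h1 : c ≤ 1 / (64 * A ^ 2) := min_le_right _ _
    have h2 : c * y ^ 2 ≤ 1 / (64 * A ^ 2) * y ^ 2 := mul_le_mul_of_nonneg_right h1 (sq_nonneg y)
    have h3 : 0 ≤ (y - 32 * A ^ 2) ^ 2 / (64 * A ^ 2) := by positivity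
    have h4 : (y - 32 * A ^ 2) ^ 2 / (64 * A ^ 2) =
        16 * A ^ 2 - 1 / (64 * A ^ 2) * y ^ 2 - (y + -(y / 4) ^ 2 / (2 * A ^ 2)) := by
      field_simp; ring
    linarith
  linarith

/-! ### Exchanging averages over products and directions -/

/-- Markov's inequality for a partial average, from a bound on the other partial averages. -/
lemma real_sqrt_lt_integral_le {X Y : Type*} [MeasurableSpace X] [MeasurableSpace Y]
    (μ : Measure X) (ν : Measure Y) [IsProbabilityMeasure μ] [IsProbabilityMeasure ν]
    (f : X × Y → ℝ) (hf : Measurable f) {C δ : ℝ} (hf0 : ∀ z, 0 ≤ f z) (hfC : ∀ z, f z ≤ C)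
    (hδ : 0 < δ) (h : ∀ y, ∫ x, f (x, y) ∂μ ≤ δ) :
    μ.real {x | √δ < ∫ y, f (x, y) ∂ν} ≤ √δ := by
  have hI : Integrable f (μ.prod ν) :=
    Integrable.of_bound hf.aestronglyMeasurable C (Filter.Eventually.of_forall fun z => by
      rw [Real.norm_eq_abs, abs_of_nonneg (hf0 z)]; exact hfC z)
  have h1 : ∫ x, ∫ y, f (x, y) ∂ν ∂μ ≤ δ := by
    rw [integral_integral_swap (f := fun x y => f (x, y)) hI]
    refine (integral_mono hI.integral_prod_right (integrable_const δ) h).trans ?_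
    simp
  have hM := mul_meas_ge_le_integral_of_nonneg (μ := μ)
    (Filter.Eventually.of_forall fun x => integral_nonneg fun y => hf0 (x, y))
    hI.integral_prod_left √δ
  have hs : 0 < √δ := Real.sqrt_pos.2 hδ
  have hsub : μ.real {x | √δ < ∫ y, f (x, y) ∂ν} ≤ μ.real {x | √δ ≤ ∫ y, f (x, y) ∂ν} :=
    measureReal_mono fun x hx => by
      rw [Set.mem_ofPred_eq] at hx ⊢
      exact hx.le
  refine hsub.trans ?_
  rw [← mul_le_mul_iff_right₀ hs, Real.mul_self_sqrt hδ.le]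
  exact hM.trans h1

/-- The version of `real_sqrt_lt_integral_le` for sets. -/
lemma real_sqrt_lt_measureReal_le {X Y : Type*} [MeasurableSpace X] [MeasurableSpace Y]
    (μ : Measure X) (ν : Measure Y) [IsProbabilityMeasure μ] [IsProbabilityMeasure ν]
    {T : Set (X × Y)} (hT : MeasurableSet T) {δ : ℝ} (hδ : 0 < δ)
    (h : ∀ y, μ.real {x | (x, y) ∈ T} ≤ δ) :
    μ.real {x | √δ < ν.real {y | (x, y) ∈ T}} ≤ √δ := by
  have h1 : ∀ x, ∫ y, T.indicator (1 : X × Y → ℝ) (x, y) ∂ν = ν.real {y | (x, y) ∈ T} :=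
    fun x => integral_indicator_one (measurable_prodMk_left hT)
  have h2 : ∀ y, ∫ x, T.indicator (1 : X × Y → ℝ) (x, y) ∂μ = μ.real {x | (x, y) ∈ T} :=
    fun y => integral_indicator_one (measurable_prodMk_right hT)
  have := real_sqrt_lt_integral_le μ ν (T.indicator 1) (measurable_const.indicator hT) (C := 1)
    (fun z => Set.indicator_nonneg (fun _ _ => zero_le_one) z)
    (fun z => Set.indicator_le_self' (fun _ _ => zero_le_one) z) hδ
    (fun y => by rw [h2]; exact h y)
  simp_rw [h1] at this
  exact this

/-! ### Rarity of trigrams of large norm -/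

lemma integral_eval_gaussianLaw {d m : ℕ} (k : Fin m) {f : E d → ℝ} (hf : Measurable f) :
    ∫ g, f (g k) ∂gaussianLaw d m = ∫ x, f x ∂stdGaussian (E d) := by
  exact integral_comp_eval (μ := fun _ : Fin m => stdGaussian (E d)) hf.aestronglyMeasurable

lemma integrable_eval_gaussianLaw {d m : ℕ} (k : Fin m) {f : E d → ℝ}
    (hf : Integrable f (stdGaussian (E d))) : Integrable (fun g => f (g k)) (gaussianLaw d m) :=
  (measurePreserving_eval (fun _ : Fin m => stdGaussian (E d)) k).integrable_comp_of_integrable hf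

/-- A bound for the weight of a subset under a softmax mixture that decouples numerator and
denominator. -/
lemma sum_mul_softmax_le {m : ℕ} [NeZero m] (x I : Fin m → ℝ) (hx : ∀ k, 0 < x k)
    (hI : ∀ k, 0 ≤ I k ∧ I k ≤ 1) {a γ : ℝ} (ha : 0 ≤ a ∧ a ≤ 1) (hγ : 0 < γ) :
    ∑ k, I k * (a * (x k / ∑ j, x j) + (1 - a) * (1 / m)) ≤
      (1 / m) * ∑ k, ((1 / (2 * γ) + 1) * I k + γ / 4 * (x k ^ 4 + (x k)⁻¹ ^ 4)) := by
  have hm : (0 : ℝ) < m := Nat.cast_pos.2 (Nat.pos_of_ne_zero (NeZero.ne m))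
  have hS : 0 < ∑ j, x j := Finset.sum_pos (fun k _ => hx k) Finset.univ_nonempty
  -- Cauchy–Schwarz in the form `m ^ 2 ≤ (∑ x j) * ∑ (x j)⁻¹`.
  have hinv : (∑ j, x j)⁻¹ ≤ (1 / m) * ((1 / m) * ∑ j, (x j)⁻¹) := by
    have h := Finset.sum_sq_le_sum_mul_sum_of_sq_le_mul Finset.univ (r := fun _ : Fin m => (1 : ℝ))
      (fun k _ => (hx k).le) (fun k _ => (inv_pos.2 (hx k)).le)
      (fun k _ => by rw [one_pow, mul_inv_cancel₀ (hx k).ne'])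
    simp only [Finset.sum_const, Finset.card_univ, Fintype.card_fin, nsmul_eq_mul, mul_one] at h
    rw [inv_le_iff_one_le_mul₀ hS]
    have e : 1 / (m : ℝ) * (1 / m * ∑ j, (x j)⁻¹) * ∑ j, x j =
        ((∑ j, x j) * ∑ j, (x j)⁻¹) / m ^ 2 := by field_simp
    rw [e, le_div_iff₀ (by positivity)]
    linarith
  -- Young's inequality, first to split the indicator from the ratio and then to split the ratio, so
  -- that every remaining term depends on one index.
  have hterm : ∀ k j, I k * (x k * (x j)⁻¹) ≤
      (1 / (2 * γ) * I k + γ / 4 * x k ^ 4) + γ / 4 * (x j)⁻¹ ^ 4 := by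
    intro k j
    set u := x k * (x j)⁻¹ with hu
    have h1 : I k * u ≤ 1 / (2 * γ) * I k ^ 2 + γ / 2 * u ^ 2 := by
      rw [← sub_nonneg]
      have : 1 / (2 * γ) * I k ^ 2 + γ / 2 * u ^ 2 - I k * u = (I k - γ * u) ^ 2 / (2 * γ) := by
        field_simp; ring
      rw [this]; positivity
    have h2 : I k ^ 2 ≤ I k := by nlinarith [hI k]
    have h3 : 1 / (2 * γ) * I k ^ 2 ≤ 1 / (2 * γ) * I k :=
      mul_le_mul_of_nonneg_left h2 (by positivity)
    have h4 : u ^ 2 ≤ (x k ^ 4 + (x j)⁻¹ ^ 4) / 2 := by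
      rw [hu, mul_pow]
      nlinarith [sq_nonneg (x k ^ 2 - (x j)⁻¹ ^ 2)]
    have h5 : γ / 2 * u ^ 2 ≤ γ / 2 * ((x k ^ 4 + (x j)⁻¹ ^ 4) / 2) :=
      mul_le_mul_of_nonneg_left h4 (by positivity)
    linarith
  have hk : ∀ k, I k * (a * (x k / ∑ j, x j) + (1 - a) * (1 / m)) ≤
      (1 / m) * ((1 / m) * ∑ j, ((1 / (2 * γ) * I k + γ / 4 * x k ^ 4) + γ / 4 * (x j)⁻¹ ^ 4)) +
        (1 / m) * I k := by
    intro k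
    have hI0 := (hI k).1
    have h1 : a * (x k / ∑ j, x j) ≤ x k * ((1 / m) * ((1 / m) * ∑ j, (x j)⁻¹)) := by
      have h2 : 0 ≤ x k / ∑ j, x j := div_nonneg (hx k).le hS.le
      have h3 : a * (x k / ∑ j, x j) ≤ x k / ∑ j, x j := mul_le_of_le_one_left h2 ha.2
      rw [div_eq_mul_inv] at h3 ⊢
      exact h3.trans (mul_le_mul_of_nonneg_left hinv (hx k).le)
    have h4 : (1 - a) * (1 / m) ≤ 1 / (m : ℝ) := mul_le_of_le_one_left (by positivity) (by linarith)
    have h5 : (1 / m : ℝ) * ((1 / m) * ∑ j, I k * (x k * (x j)⁻¹)) ≤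
        (1 / m) * ((1 / m) * ∑ j, ((1 / (2 * γ) * I k + γ / 4 * x k ^ 4) +
          γ / 4 * (x j)⁻¹ ^ 4)) := by
      gcongr with j _
      exact hterm k j
    have h6 : (1 / m : ℝ) * ((1 / m) * ∑ j, I k * (x k * (x j)⁻¹)) =
        I k * (x k * ((1 / m) * ((1 / m) * ∑ j, (x j)⁻¹))) := by
      simp_rw [← Finset.mul_sum]; ring
    rw [h6] at h5
    have h7 := mul_le_mul_of_nonneg_left (add_le_add h1 h4) hI0
    linarith
  refine (Finset.sum_le_sum fun k _ => hk k).trans (le_of_eq ?_)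
  rw [Finset.sum_add_distrib, ← Finset.mul_sum, ← Finset.mul_sum, ← Finset.mul_sum, ← mul_add]
  congr 1
  simp only [Finset.sum_add_distrib, Finset.sum_const, Finset.card_univ, Fintype.card_fin,
    nsmul_eq_mul, ← Finset.mul_sum, mul_add, add_mul]
  have hm' := hm.ne'
  field_simp
  ring

/-- For a fixed product, the expected probability of choosing a trigram with a direction of large
norm. -/
lemma integral_sum_indicator_trigramProb_le {d m : ℕ} [NeZero m] (s : Fin m → ℝ) {a b A r P : ℝ}
    (hs : ∀ k, |b * s k| ≤ A) (ha : 0 ≤ a ∧ a ≤ 1) (hP : 0 < P ∧ P ≤ 1)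
    (hr : (stdGaussian (E d)).real {x | r < ‖x‖} ≤ P) (p : Product d) :
    ∫ g, ∑ k, {x : E d | r < ‖x‖}.indicator 1 (g k) * trigramProb (trigramVectors s g) a b p k
      ∂gaussianLaw d m ≤ (3 / 2 + exp (8 * A ^ 2) / 2) * √P := by
  have hm : (0 : ℝ) < m := Nat.cast_pos.2 (Nat.pos_of_ne_zero (NeZero.ne m))
  set S : Set (E d) := {x | r < ‖x‖} with hS
  have hSm : MeasurableSet S := measurableSet_lt measurable_const (by fun_prop)
  -- This balances the indicator contribution `P / (2 * γ)` against the moment contribution of order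
  -- `γ`.
  set γ := √P with hγ
  have hγ0 : 0 < γ := Real.sqrt_pos.2 hP.1
  have hγP : γ * γ = P := Real.mul_self_sqrt hP.1.le
  have hγ1 : γ ≤ 1 := Real.sqrt_le_one.2 hP.2
  set u : Fin m → E d := fun k => (b * s k) • (p : E d) with hu
  set φ : Fin m → E d → ℝ := fun k x => (1 / (2 * γ) + 1) * S.indicator 1 x +
    γ / 4 * (exp (inner ℝ ((4 : ℕ) • u k) x) + exp (inner ℝ ((4 : ℕ) • (-u k)) x)) with hφ
  have hI01 : ∀ x : E d, 0 ≤ S.indicator (1 : E d → ℝ) x ∧ S.indicator (1 : E d → ℝ) x ≤ 1 :=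
    fun x => ⟨Set.indicator_nonneg (fun _ _ => zero_le_one) x,
      Set.indicator_le_self' (fun _ _ => zero_le_one) x⟩
  have hpt : ∀ g : Fin m → E d,
      ∑ k, S.indicator 1 (g k) * trigramProb (trigramVectors s g) a b p k ≤
        (1 / m) * ∑ k, φ k (g k) := by
    intro g
    have h := sum_mul_softmax_le (fun k => exp (inner ℝ (u k) (g k)))
      (fun k => S.indicator 1 (g k)) (fun k => exp_pos _) (fun k => hI01 _) ha hγ0
    simp only [trigramProb, partitionFn, mul_inner_trigramVectors]
    refine h.trans (le_of_eq ?_)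
    congr 1
    refine Finset.sum_congr rfl fun k _ => ?_
    simp only [hφ]
    rw [← exp_neg, ← inner_neg_left, exp_inner_pow, exp_inner_pow]
    simp only [Nat.cast_smul_eq_nsmul]
  have hI1 : Integrable (fun x => (1 / (2 * γ) + 1) * S.indicator (1 : E d → ℝ) x)
      (stdGaussian (E d)) := ((integrable_const (1 : ℝ)).indicator hSm).const_mul _
  have hI2 : ∀ k, Integrable (fun x => γ / 4 * (exp (inner ℝ ((4 : ℕ) • u k) x) +
      exp (inner ℝ ((4 : ℕ) • (-u k)) x))) (stdGaussian (E d)) := fun k =>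
    ((integrable_exp_inner_stdGaussian _).add (integrable_exp_inner_stdGaussian _)).const_mul _
  have hφI : ∀ k, Integrable (φ k) (stdGaussian (E d)) := fun k => hI1.add (hI2 k)
  have hφm : ∀ k, Measurable (φ k) := fun k => by
    have : Measurable (S.indicator (1 : E d → ℝ)) := measurable_const.indicator hSm
    fun_prop
  have h4 : ∀ k, ∀ w : E d, ‖w‖ ^ 2 = (b * s k) ^ 2 →
      ∫ x, exp (inner ℝ ((4 : ℕ) • w) x) ∂stdGaussian (E d) ≤ exp (8 * A ^ 2) := by
    intro k w hw
    rw [integral_exp_inner_stdGaussian, ← Nat.cast_smul_eq_nsmul ℝ, norm_smul, mul_pow, hw, exp_le_exp]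
    have : (b * s k) ^ 2 ≤ A ^ 2 := by
      rw [← sq_abs]; exact pow_le_pow_left₀ (abs_nonneg _) (hs k) 2
    norm_num
    linarith
  have hφb : ∀ k, ∫ x, φ k x ∂stdGaussian (E d) ≤ (3 / 2 + exp (8 * A ^ 2) / 2) * γ := by
    intro k
    have hn : ‖u k‖ ^ 2 = (b * s k) ^ 2 := norm_smul_product_sq _ p
    have e : ∫ x, φ k x ∂stdGaussian (E d) = (1 / (2 * γ) + 1) * (stdGaussian (E d)).real S +
        γ / 4 * (∫ x, exp (inner ℝ ((4 : ℕ) • u k) x) ∂stdGaussian (E d) +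
          ∫ x, exp (inner ℝ ((4 : ℕ) • (-u k)) x) ∂stdGaussian (E d)) := by
      rw [← integral_add (integrable_exp_inner_stdGaussian _) (integrable_exp_inner_stdGaussian _),
        ← integral_const_mul, ← integral_indicator_one hSm, ← integral_const_mul,
        ← integral_add hI1 (hI2 k)]
    rw [e]
    have h1 : (1 / (2 * γ) + 1) * (stdGaussian (E d)).real S ≤ (1 / (2 * γ) + 1) * P :=
      mul_le_mul_of_nonneg_left hr (by positivity)
    have h2 : (1 / (2 * γ) + 1) * P = γ / 2 + γ * γ := by rw [← hγP]; field_simp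
    have h3 : γ * γ ≤ γ * 1 := mul_le_mul_of_nonneg_left hγ1 hγ0.le
    have h5 := mul_le_mul_of_nonneg_left
      (add_le_add (h4 k (u k) hn) (h4 k (-u k) (by rw [norm_neg]; exact hn)))
      (show 0 ≤ γ / 4 by positivity)
    linarith
  have hsumI : Integrable (fun g : Fin m → E d => (1 / m : ℝ) * ∑ k, φ k (g k))
      (gaussianLaw d m) :=
    (integrable_finsetSum _ fun k _ => integrable_eval_gaussianLaw k (hφI k)).const_mul _
  refine (integral_mono_of_nonneg (Filter.Eventually.of_forall fun g => ?_) hsumI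
    (Filter.Eventually.of_forall hpt)).trans ?_
  · exact Finset.sum_nonneg fun k _ => mul_nonneg (hI01 _).1 (trigramProb_nonneg _ ha _ _ _)
  · rw [integral_const_mul, integral_finsetSum _ fun k _ => integrable_eval_gaussianLaw k (hφI k)]
    calc _ ≤ (1 / m : ℝ) * ∑ _k : Fin m, (3 / 2 + exp (8 * A ^ 2) / 2) * γ := by
          refine mul_le_mul_of_nonneg_left (Finset.sum_le_sum fun k _ => ?_) (by positivity)
          rw [integral_eval_gaussianLaw k (hφm k)]
          exact hφb k
      _ = _ := by
          simp only [Finset.sum_const, Finset.card_univ, Fintype.card_fin, nsmul_eq_mul]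
          field_simp

lemma measurable_trigramProb_uncurry {d m : ℕ} (s : Fin m → ℝ) (a b : ℝ) (k : Fin m) :
    Measurable fun z : (Fin m → E d) × Product d =>
      trigramProb (trigramVectors s z.1) a b z.2 k := by
  unfold trigramProb partitionFn trigramVectors
  fun_prop

lemma measurable_partitionFn_uncurry {d m : ℕ} (s : Fin m → ℝ) (b : ℝ) :
    Measurable fun z : (Fin m → E d) × Product d =>
      partitionFn (trigramVectors s z.1) b z.2 := by
  unfold partitionFn trigramVectors
  fun_prop

/-- With high probability over the trigram vectors, the model rarely uses trigrams of large norm. -/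
lemma queryLaw_not_normBounded_concentration {d m : ℕ} [NeZero d] [NeZero m] (N : ℕ) {lam : ℝ}
    (hl : 0 < lam) (s : Fin m → ℝ) {α β : ℕ → ℝ} (hα : ∀ i, 0 ≤ α i ∧ α i ≤ 1) {A κ b P : ℝ}
    (hκ : 0 < κ) (hsκ : ∀ k, |s k| ≤ κ) (hA : ∀ i k, |β i * s k| ≤ A) (hP : 0 < P ∧ P ≤ 1)
    (hr : (stdGaussian (E d)).real {x | b / κ * √d < ‖x‖} ≤ P) :
    (gaussianLaw d m).real {g | √((N * (3 / 2 + exp (8 * A ^ 2) / 2) + 1) * √P) <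
      (queryLaw N lam (trigramVectors s g) α β).real {q | ¬ NormBounded b (trigramVectors s g) q}} ≤
      √((N * (3 / 2 + exp (8 * A ^ 2) / 2) + 1) * √P) := by
  classical
  set S : Set (E d) := {x | b / κ * √d < ‖x‖} with hS
  have hSm : MeasurableSet S := measurableSet_lt measurable_const (by fun_prop)
  have hI01 : ∀ x : E d, 0 ≤ S.indicator (1 : E d → ℝ) x ∧ S.indicator (1 : E d → ℝ) x ≤ 1 :=
    fun x => ⟨Set.indicator_nonneg (fun _ _ => zero_le_one) x,
      Set.indicator_le_self' (fun _ _ => zero_le_one) x⟩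
  have hP0 := Real.sqrt_pos.2 hP.1
  set f : (Fin m → E d) × Product d → ℝ := fun z => ∑ i ∈ Finset.range N, ∑ k,
    S.indicator 1 (z.1 k) * trigramProb (trigramVectors s z.1) (α i) (β i) z.2 k with hf
  have htm : ∀ i k, Measurable fun z : (Fin m → E d) × Product d =>
      S.indicator (1 : E d → ℝ) (z.1 k) * trigramProb (trigramVectors s z.1) (α i) (β i) z.2 k := by
    intro i k
    refine Measurable.mul ?_ (measurable_trigramProb_uncurry s _ _ k)
    exact (measurable_const.indicator hSm : Measurable (S.indicator (1 : E d → ℝ))).comp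
      ((measurable_pi_apply k).comp measurable_fst)
  have hfm : Measurable f := Finset.measurable_sum _ fun i _ => Finset.measurable_sum _ fun k _ =>
    htm i k
  have ht0 : ∀ i k (z : (Fin m → E d) × Product d), 0 ≤ S.indicator (1 : E d → ℝ) (z.1 k) *
      trigramProb (trigramVectors s z.1) (α i) (β i) z.2 k := fun i k z =>
    mul_nonneg (hI01 _).1 (trigramProb_nonneg _ (hα i) _ _ _)
  have ht1 : ∀ i (z : (Fin m → E d) × Product d), ∑ k, S.indicator (1 : E d → ℝ) (z.1 k) *
      trigramProb (trigramVectors s z.1) (α i) (β i) z.2 k ≤ 1 := fun i z => by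
    rw [← sum_trigramProb (trigramVectors s z.1) (α i) (β i) z.2]
    exact Finset.sum_le_sum fun k _ =>
      mul_le_of_le_one_left (trigramProb_nonneg _ (hα i) _ _ _) (hI01 _).2
  have hf0 : ∀ z, 0 ≤ f z := fun z => Finset.sum_nonneg fun i _ => Finset.sum_nonneg fun k _ =>
    ht0 i k z
  have hfN : ∀ z, f z ≤ N := fun z =>
    (Finset.sum_le_sum fun i _ => ht1 i z).trans (by simp)
  -- The summand `1` keeps the bound positive when `N = 0`, as the Markov step requires.
  have hfδ : ∀ p, ∫ g, f (g, p) ∂gaussianLaw d m ≤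
      (N * (3 / 2 + exp (8 * A ^ 2) / 2) + 1) * √P := by
    intro p
    simp only [hf]
    rw [integral_finsetSum]
    · refine (Finset.sum_le_sum fun i _ =>
        integral_sum_indicator_trigramProb_le s (hA i) (hα i) hP hr p).trans ?_
      rw [Finset.sum_const, Finset.card_range, nsmul_eq_mul]
      linarith
    · intro i _
      have hmi : Measurable fun z : (Fin m → E d) × Product d =>
          ∑ k, S.indicator (1 : E d → ℝ) (z.1 k) *
            trigramProb (trigramVectors s z.1) (α i) (β i) z.2 k :=
        Finset.measurable_sum _ fun k _ => htm i k
      refine Integrable.of_bound (hmi.comp measurable_prodMk_right).aestronglyMeasurable 1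
        (Filter.Eventually.of_forall fun g => ?_)
      rw [Real.norm_eq_abs, abs_of_nonneg (Finset.sum_nonneg fun k _ => ht0 i k (g, p))]
      exact ht1 i (g, p)
  refine le_trans (measureReal_mono fun g hg => ?_) (real_sqrt_lt_integral_le (gaussianLaw d m)
    (productLaw d) f hfm hf0 hfN (by positivity) hfδ)
  rw [Set.mem_ofPred_eq] at hg ⊢
  refine lt_of_lt_of_le hg ?_
  -- Since `|s k| ≤ κ`, a trigram longer than `b * √d` has a direction longer than `b / κ * √d`,
  -- with `b / κ` the ratio in the norm tail hypothesis.
  have hsub : {q : Query m N | ¬ NormBounded b (trigramVectors s g) q} ⊆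
      {q | ∃ i, q.2 i ∈ {k | g k ∈ S}} := by
    intro q hq
    obtain ⟨i, hi⟩ := not_forall.1 hq
    refine ⟨i, ?_⟩
    change b / κ * √d < ‖g (q.2 i)‖
    rw [not_le, trigramVectors, norm_smul, Real.norm_eq_abs] at hi
    rw [div_mul_eq_mul_div, div_lt_iff₀ hκ]
    have := mul_le_mul_of_nonneg_right (hsκ (q.2 i)) (norm_nonneg (g (q.2 i)))
    linarith
  have hfin : IsFiniteMeasure (queryLaw N lam (trigramVectors s g) α β) := by
    constructor
    rw [queryLaw_apply]
    have hq1 : ∀ p : Product d, ∑ q : Query m N,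
        ENNReal.ofReal (queryProbGiven N lam (trigramVectors s g) α β p q) *
          (Set.univ : Set (Query m N)).indicator 1 q = 1 := by
      intro p
      simp only [Set.mem_univ, Set.indicator_of_mem, Pi.one_apply, mul_one]
      rw [← ENNReal.ofReal_sum_of_nonneg fun q _ => queryProbGiven_nonneg N _ β hl hα p q,
        Fintype.sum_sigma]
      simp [queryProbGiven, ← Finset.mul_sum, sum_prod_trigramProb, sum_lengthProb hl]
    simp_rw [hq1]
    simp
  refine (measureReal_mono hsub).trans ((queryLaw_exists_mem_le N _ β hl hα {k | g k ∈ S}).trans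
    (le_of_eq ?_))
  congr with p
  refine Finset.sum_congr rfl fun i _ => Finset.sum_congr rfl fun k _ => ?_
  by_cases hk : g k ∈ S <;> simp [hk]

/-! ### Decay in `log m`, and concentration for most products -/

lemma exp_neg_mul_sq_le {a : ℝ} (ha : 0 < a) (n y : ℝ) :
    exp (-a * y ^ 2) ≤ exp (n ^ 2 / (4 * a)) * exp (-n * y) := by
  rw [← exp_add, exp_le_exp, ← sub_nonneg]
  have : n ^ 2 / (4 * a) + -n * y - -a * y ^ 2 = (2 * a * y - n) ^ 2 / (4 * a) := by
    field_simp; ring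
  rw [this]
  positivity

/-- Below this threshold the final probability bound is made trivial by the constant; above it the
error is at most `1 / 2`, as the comparison of query probabilities requires. -/
lemma exists_forall_log_div_sqrt_le (C : ℝ) (hC : 0 < C) :
    ∃ m₀ : ℕ, 2 ≤ m₀ ∧ ∀ m : ℕ, m₀ ≤ m → epsZ C m ≤ 1 / 2 := by
  have h1 := (isLittleO_log_rpow_atTop (show (0 : ℝ) < 1 / 2 by norm_num)).comp_tendsto
    tendsto_natCast_atTop_atTop
  have h2 := h1.bound (show (0 : ℝ) < 1 / (2 * C) by positivity)
  obtain ⟨m₁, hm₁⟩ := Filter.eventually_atTop.1 h2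
  refine ⟨max m₁ 2, le_max_right _ _, fun m hm => ?_⟩
  have hm2 : 2 ≤ m := (le_max_right _ _).trans hm
  have hm0 : (0 : ℝ) < m := by positivity
  have h := hm₁ m ((le_max_left _ _).trans hm)
  have hs : 0 < √(m : ℝ) := Real.sqrt_pos.2 hm0
  simp only [Function.comp_apply, Real.norm_eq_abs] at h
  rw [← sqrt_eq_rpow, abs_of_pos hs] at h
  have h3 := (le_abs_self _).trans h
  rw [epsZ, ← mul_div_assoc, div_le_iff₀ hs]
  have h4 := mul_le_mul_of_nonneg_left h3 hC.le
  have h5 : C * (1 / (2 * C) * √(m : ℝ)) = 1 / 2 * √m := by field_simp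
  linarith

/-- Gaussian decay in `log m` beats any power of `m`. -/
lemma exp_neg_mul_log_sq_mul_pow_le {a : ℝ} (ha : 0 < a) (n m : ℕ) (hm : 2 ≤ m) :
    exp (-a * log m ^ 2) * (m : ℝ) ^ n ≤
      2 * exp ((n + 1) ^ 2 / (4 * a)) * (log m / √m) := by
  have hm2 : (2 : ℝ) ≤ m := by exact_mod_cast hm
  have hm0 : (0 : ℝ) < m := by linarith
  have hs : 0 < √(m : ℝ) := Real.sqrt_pos.2 hm0
  -- This is where `2 ≤ m` matters: the target `log m / √m` vanishes at `m = 1`.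
  have hy : 1 / 2 ≤ log m := by
    have := log_two_gt_d9
    have := log_le_log (by norm_num) hm2
    linarith
  have h1 := exp_neg_mul_sq_le ha (n + 1) (log m)
  have h2 : exp (-(n + 1 : ℝ) * log m) * (m : ℝ) ^ n = 1 / m := by
    have hpow : (m : ℝ) ^ n = exp (n * log m) := by rw [exp_nat_mul, exp_log hm0]
    rw [hpow, ← exp_add, show -(n + 1 : ℝ) * log m + n * log m = -log m by ring, exp_neg,
      exp_log hm0, one_div]
  have h3 : 1 / (m : ℝ) ≤ 2 * (log m / √m) := by
    rw [← mul_div_assoc, div_le_div_iff₀ hm0 hs]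
    have h4 : √(m : ℝ) ≤ m := by
      rw [Real.sqrt_le_left hm0.le]; nlinarith
    have h5 : 1 * (m : ℝ) ≤ 2 * log m * m := mul_le_mul_of_nonneg_right (by linarith) hm0.le
    linarith
  calc exp (-a * log m ^ 2) * (m : ℝ) ^ n
      ≤ exp ((n + 1) ^ 2 / (4 * a)) * exp (-(n + 1 : ℝ) * log m) * m ^ n := by gcongr
    _ = exp ((n + 1) ^ 2 / (4 * a)) * (1 / m) := by rw [mul_assoc, h2]
    _ ≤ exp ((n + 1) ^ 2 / (4 * a)) * (2 * (log m / √m)) := by gcongr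
    _ = _ := by ring

lemma partitionFn_bounds_mono {ε ε' z w : ℝ} (hε : ε ≤ ε') (hz : 0 ≤ z)
    (h : (1 - ε) * z ≤ w ∧ w ≤ (1 + ε) * z) : (1 - ε') * z ≤ w ∧ w ≤ (1 + ε') * z := by
  have := mul_le_mul_of_nonneg_right hε hz
  constructor
  · linarith [h.1]
  · linarith [h.2]

/-- With high probability over the directions, the partition function concentrates for most
products. -/
lemma partitionFn_concentration_productLaw {d m : ℕ} [NeZero d] [NeZero m] (s : Fin m → ℝ)
    {b A δ : ℝ} (hA : 0 < A) (hs : ∀ k, |b * s k| ≤ A)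
    (hδ : δ = (2 + exp (16 * A ^ 2)) * exp (-(min (3 / 16) (1 / (64 * A ^ 2))) * log m ^ 2)) :
    (gaussianLaw d m).real {g | √δ < (productLaw d).real {p | ¬ (
        (1 - epsZ (exp (2 * A ^ 2)) m) * meanPartitionFn s b ≤
          partitionFn (trigramVectors s g) b p ∧
        partitionFn (trigramVectors s g) b p ≤
          (1 + epsZ (exp (2 * A ^ 2)) m) * meanPartitionFn s b)}} ≤ √δ := by
  have hm := measurable_partitionFn_uncurry (d := d) s b
  exact real_sqrt_lt_measureReal_le (gaussianLaw d m) (productLaw d)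
    (T := {z | ¬ ((1 - epsZ (exp (2 * A ^ 2)) m) * meanPartitionFn s b ≤
          partitionFn (trigramVectors s z.1) b z.2 ∧
        partitionFn (trigramVectors s z.1) b z.2 ≤
          (1 + epsZ (exp (2 * A ^ 2)) m) * meanPartitionFn s b)})
    ((measurableSet_le measurable_const hm).inter (measurableSet_le hm measurable_const)).compl
    (by rw [hδ]; positivity) fun p => by rw [hδ]; exact partitionFn_concentration s hA hs p

lemma sqrt_mul_exp {a : ℝ} (ha : 0 ≤ a) (x : ℝ) : √(a * exp x) = √a * exp (x / 2) := by
  rw [Real.sqrt_mul ha, Real.exp_half]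

end AttEST

end

/-! ### Choice of constants and assembly of the theorem -/

set_option maxHeartbeats 2000000 in
open AttEST in
theorem theorem2 (N : ℕ) (B κ b : ℝ) (hκ : 0 < κ) (hb : κ < b) :
    ∃ C > 0, ∃ c > 0, ∀ (d m : ℕ), 1 ≤ d → 1 ≤ m →
      ∀ (s : Fin m → ℝ) (β : ℕ → ℝ), (∀ k, |s k| ≤ κ) → (∀ i, |β i| ≤ B) →
      ∃ Z : ℕ → ℝ, (∀ i, 0 < Z i) ∧
      ∀ (α : ℕ → ℝ) (lam : ℝ), (∀ i, 1 / 2 < α i ∧ α i ≤ 1) → 0 < lam →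
        (AttEST.gaussianLaw d m).real {g | ¬ (
            (∀ i < N, (AttEST.productLaw d).real {p | ¬ (
                (1 - AttEST.epsZ C m) * Z i ≤
                    AttEST.partitionFn (AttEST.trigramVectors s g) (β i) p ∧
                AttEST.partitionFn (AttEST.trigramVectors s g) (β i) p ≤
                    (1 + AttEST.epsZ C m) * Z i)}
              ≤ C * Real.exp (-c * Real.log m ^ 2)) ∧
            (AttEST.queryLaw N lam (AttEST.trigramVectors s g) α β).real
                {q | ¬ AttEST.NormBounded b (AttEST.trigramVectors s g) q}
              ≤ C * Real.exp (-c * d) ∧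
            ∀ q : AttEST.Query m N,
              AttEST.NormBounded b (AttEST.trigramVectors s g) q →
              |AttEST.queryProb N lam (AttEST.trigramVectors s g) α β q -
                  AttEST.approxProb (AttEST.trigramVectors s g) α β Z q| ≤
                AttEST.epsQuery C d α q *
                  AttEST.approxProb (AttEST.trigramVectors s g) α β Z q)}
          ≤ C * Real.exp (-c * Real.log m ^ 2) + C * Real.exp (-c * d) := by
  have hb0 : 0 < b := hκ.trans hb
  -- A bound for all `|β i * s k|`; the `1` makes it positive, and `|B|` avoids a sign assumption on
  -- `B`.
  set A : ℝ := |B| * κ + 1 with hA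
  have hA0 : 0 < A := by positivity
  set K : ℝ := Real.exp (A ^ 2 / 2) with hK
  have hK1 : 1 ≤ K := Real.one_le_exp (by positivity)
  set C₀ : ℝ := Real.exp (2 * A ^ 2) with hC₀
  have hC₀0 : 0 < C₀ := Real.exp_pos _
  obtain ⟨m₀, hm₀2, hm₀⟩ := exists_forall_log_div_sqrt_le C₀ hC₀0
  set C₁ : ℝ := 2 + Real.exp (16 * A ^ 2) with hC₁
  have hC₁0 : 0 < C₁ := by positivity
  set c₁ : ℝ := min (3 / 16) (1 / (64 * A ^ 2)) with hc₁
  have hc₁0 : 0 < c₁ := lt_min (by norm_num) (by positivity)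
  have hρ : 1 < b / κ := (one_lt_div hκ).2 hb
  set c₂ : ℝ := ((b / κ) ^ 2 - 1 - Real.log ((b / κ) ^ 2)) / 2 with hc₂
  have hc₂0 : 0 < c₂ := by
    have h1 : 1 < (b / κ) ^ 2 := one_lt_pow₀ hρ (by norm_num)
    have := Real.log_lt_sub_one_of_pos (by linarith) h1.ne'
    rw [hc₂]; linarith
  set D : ℝ := N * (3 / 2 + Real.exp (8 * A ^ 2) / 2) + 1 with hD
  have hD0 : 0 < D := by positivity
  set M : ℝ := (N * (|B| * b)) ^ 2 / 2 with hM
  set Q : ℝ := (2 + K) ^ N * (2 ^ N * Real.exp M) with hQ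
  have hQ0 : 0 < Q := by positivity
  set G : ℝ := (1 + Real.exp (4 * M)) / 2 with hG
  have hG0 : 0 < G := by positivity
  -- A union bound over `N` positions; `N + 1` keeps it positive for `N = 0` and at least `√C₁`.
  set η₀ : ℝ := (N + 1) * √C₁ with hη₀
  have hη₀0 : 0 < η₀ := by have := Real.sqrt_pos.2 hC₁0; positivity
  set H₁ : ℝ := 2 * Real.exp ((N + 1) ^ 2 / (4 * (c₁ / 2))) with hH₁
  set H₂ : ℝ := 2 * Real.exp ((((0 : ℕ) : ℝ) + 1) ^ 2 / (4 * (c₁ / 4))) with hH₂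
  -- One square root (Markov) halves `c₁`; two (the choice of `γ`, then Markov) quarter `c₂`.
  set c : ℝ := min (c₁ / 2) (c₂ / 4) with hc
  have hc0 : 0 < c := lt_min (by linarith) (by linarith)
  have hsC₁ : 0 < √C₁ := Real.sqrt_pos.2 hC₁0
  have hsD : 0 < √D := Real.sqrt_pos.2 hD0
  set Y : ℝ := 2 * N * C₀ * Q + η₀ * (2 * K) ^ N * H₁ + √η₀ * H₂ * G with hY
  have hY0 : 0 ≤ Y := by positivity
  -- `Y`, `2 * K * Q` and `M ^ 2` serve the three terms of the query error, `C₀` the partition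
  -- function error, `η₀` and `√D` the probabilities, and the last summand the case `m < m₀`.
  set C : ℝ := Y + 2 * K * Q + M ^ 2 + C₀ + η₀ + √D + Real.exp (c * Real.log m₀ ^ 2) with hC
  have hE := Real.exp_pos (c * Real.log m₀ ^ 2)
  have hKQ : 0 < 2 * K * Q := by positivity
  have hM2 : 0 ≤ M ^ 2 := sq_nonneg _
  have hC0 : 0 < C := by positivity
  refine ⟨C, hC0, c, hc0, fun d m hd hm s β hs hβ => ?_⟩
  have : NeZero d := ⟨by omega⟩
  have : NeZero m := ⟨by omega⟩
  have hm1 : (1 : ℝ) ≤ m := by exact_mod_cast hm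
  have hd1 : (1 : ℝ) ≤ d := by exact_mod_cast hd
  have hZm : ∀ i, (m : ℝ) ≤ meanPartitionFn s (β i) := fun i => le_meanPartitionFn s (β i)
  have hβB : ∀ i, |β i| ≤ |B| := fun i => (hβ i).trans (le_abs_self B)
  have hβs : ∀ i k, |β i * s k| ≤ A := fun i k => by
    rw [abs_mul]
    have := mul_le_mul (hβB i) (hs k) (abs_nonneg _) (abs_nonneg _)
    linarith
  -- The Gaussian mean of the partition function, which involves only `s` and `β i`.
  refine ⟨fun i => meanPartitionFn s (β i), fun i => by linarith [hZm i], fun α lam hα hl => ?_⟩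
  have hα' : ∀ i, 0 ≤ α i ∧ α i ≤ 1 := fun i => ⟨by linarith [(hα i).1], (hα i).2⟩
  have hlog0 : 0 ≤ Real.log m := Real.log_nonneg hm1
  have hed : 0 ≤ C * Real.exp (-c * d) := by positivity
  -- For `m < m₀` the claimed bound on the probability is at least `1`.
  rcases lt_or_ge m m₀ with hmm | hmm
  · have h1 : Real.log m ≤ Real.log m₀ :=
      Real.log_le_log (by linarith) (by exact_mod_cast hmm.le)
    have h2 : Real.log m ^ 2 ≤ Real.log m₀ ^ 2 := pow_le_pow_left₀ hlog0 h1 2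
    have h3 : 1 ≤ C * Real.exp (-c * Real.log m ^ 2) := by
      calc (1 : ℝ) = Real.exp (c * Real.log m₀ ^ 2) * Real.exp (-c * Real.log m₀ ^ 2) := by
            rw [← Real.exp_add]; simp
        _ ≤ C * Real.exp (-c * Real.log m ^ 2) := by
            refine mul_le_mul ?_ (Real.exp_le_exp.2 ?_) (Real.exp_pos _).le hC0.le
            · rw [hC]; linarith
            · have := mul_le_mul_of_nonneg_left h2 hc0.le
              linarith
    refine measureReal_le_one.trans ?_
    linarith
  have hm2 : 2 ≤ m := hm₀2.trans hmm
  set δ : ℝ := C₁ * Real.exp (-c₁ * Real.log m ^ 2) with hδ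
  set P : ℝ := Real.exp (-c₂ * d) with hP
  have hP1 : P ≤ 1 := Real.exp_le_one_iff.2 (by nlinarith)
  have hsδ : √δ = √C₁ * Real.exp (-(c₁ / 2) * Real.log m ^ 2) := by
    rw [hδ, sqrt_mul_exp hC₁0.le]; congr 2; ring
  have hsδ2 : √(D * √P) = √D * Real.exp (-(c₂ / 4) * d) := by
    rw [hP, ← one_mul (Real.exp (-c₂ * d)), sqrt_mul_exp zero_le_one, Real.sqrt_one, one_mul,
      sqrt_mul_exp hD0.le]
    congr 2; ring
  have hexpm : Real.exp (-(c₁ / 2) * Real.log m ^ 2) ≤ Real.exp (-c * Real.log m ^ 2) := by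
    rw [Real.exp_le_exp]
    have := mul_le_mul_of_nonneg_right (min_le_left (c₁ / 2) (c₂ / 4)) (sq_nonneg (Real.log m))
    linarith
  have hexpd : Real.exp (-(c₂ / 4) * d) ≤ Real.exp (-c * d) := by
    rw [Real.exp_le_exp]
    have := mul_le_mul_of_nonneg_right (min_le_right (c₁ / 2) (c₂ / 4)) (by linarith : (0 : ℝ) ≤ d)
    linarith
  have hs1 : √C₁ ≤ η₀ := by
    rw [hη₀]
    have : 0 ≤ (N : ℝ) * √C₁ := by positivity
    linarith
  have hη₀C : η₀ ≤ C := by rw [hC]; linarith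
  have hDC : √D ≤ C := by rw [hC]; linarith
  -- products and directions outside the good event
  set exc : ℕ → (Fin m → E d) → Set (Product d) := fun i g => {p | ¬ (
        (1 - epsZ C₀ m) * meanPartitionFn s (β i) ≤
          partitionFn (trigramVectors s g) (β i) p ∧
        partitionFn (trigramVectors s g) (β i) p ≤
          (1 + epsZ C₀ m) * meanPartitionFn s (β i))} with hexc
  set bad₁ : ℕ → Set (Fin m → E d) := fun i => {g | √δ < (productLaw d).real (exc i g)} with hbad₁
  set bad₂ : Set (Fin m → E d) := {g | √(D * √P) <
      (queryLaw N lam (trigramVectors s g) α β).real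
        {q | ¬ NormBounded b (trigramVectors s g) q}} with hbad₂
  have hb1 : ∀ i, (gaussianLaw d m).real (bad₁ i) ≤ √δ := fun i =>
    partitionFn_concentration_productLaw s hA0 (hβs i) hδ
  have hb2 : (gaussianLaw d m).real bad₂ ≤ √(D * √P) :=
    queryLaw_not_normBounded_concentration N hl s hα' hκ hs hβs ⟨Real.exp_pos _, hP1⟩
      (stdGaussian_norm_tail hρ)
  have hbad : (gaussianLaw d m).real ((⋃ i ∈ Finset.range N, bad₁ i) ∪ bad₂) ≤
      C * Real.exp (-c * Real.log m ^ 2) + C * Real.exp (-c * d) := by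
    refine (measureReal_union_le _ _).trans (add_le_add ?_ ?_)
    · refine (measureReal_biUnion_finset_le _ _).trans
        ((Finset.sum_le_sum fun i _ => hb1 i).trans ?_)
      rw [Finset.sum_const, Finset.card_range, nsmul_eq_mul, hsδ, ← mul_assoc]
      refine mul_le_mul ?_ hexpm (Real.exp_pos _).le hC0.le
      refine le_trans ?_ hη₀C
      rw [hη₀]; linarith
    · refine hb2.trans ?_
      rw [hsδ2]
      exact mul_le_mul hDC hexpd (Real.exp_pos _).le hC0.le
  refine (measureReal_mono fun g hg => ?_).trans hbad
  by_contra hgn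
  rw [Set.mem_union, not_or, Set.mem_iUnion₂] at hgn
  have hg1 : ∀ i < N, (productLaw d).real (exc i g) ≤ √δ := fun i hi => by
    by_contra h
    exact hgn.1 ⟨i, Finset.mem_range.2 hi, not_le.1 h⟩
  have hg2 : (queryLaw N lam (trigramVectors s g) α β).real
      {q | ¬ NormBounded b (trigramVectors s g) q} ≤ √(D * √P) := by
    by_contra h
    exact hgn.2 (not_le.1 h)
  refine hg ⟨fun i hi => ?_, ?_, fun q hq => ?_⟩
  · have hεC : epsZ C₀ m ≤ epsZ C m := by
      unfold epsZ
      refine mul_le_mul_of_nonneg_right ?_ (by positivity)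
      rw [hC]; linarith
    refine (measureReal_mono fun p hp => ?_).trans ((hg1 i hi).trans ?_)
    · exact fun h => hp (partitionFn_bounds_mono hεC (by linarith [hZm i]) h)
    · rw [hsδ]
      exact mul_le_mul (hs1.trans hη₀C) hexpm (Real.exp_pos _).le hC0.le
  · refine hg2.trans ?_
    rw [hsδ2]
    exact mul_le_mul hDC hexpd (Real.exp_pos _).le hC0.le
  · set η : ℝ := η₀ * Real.exp (-(c₁ / 2) * Real.log m ^ 2) with hη
    have hη0 : 0 < η := by positivity
    have hεm0 : 0 ≤ epsZ C₀ m := by unfold epsZ; positivity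
    have hbadη : (productLaw d).real {p | ∃ i < N, ¬ (
        (1 - epsZ C₀ m) * meanPartitionFn s (β i) ≤ partitionFn (trigramVectors s g) (β i) p ∧
        partitionFn (trigramVectors s g) (β i) p ≤
          (1 + epsZ C₀ m) * meanPartitionFn s (β i))} ≤ η := by
      have e : {p | ∃ i < N, ¬ (
        (1 - epsZ C₀ m) * meanPartitionFn s (β i) ≤ partitionFn (trigramVectors s g) (β i) p ∧
        partitionFn (trigramVectors s g) (β i) p ≤
          (1 + epsZ C₀ m) * meanPartitionFn s (β i))} = ⋃ i ∈ Finset.range N, exc i g := by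
        ext p; simp [hexc]
      rw [e]
      refine (measureReal_biUnion_finset_le _ _).trans
        ((Finset.sum_le_sum fun i hi => hg1 i (Finset.mem_range.1 hi)).trans ?_)
      rw [Finset.sum_const, Finset.card_range, nsmul_eq_mul, hsδ, ← mul_assoc, hη]
      refine mul_le_mul_of_nonneg_right ?_ (Real.exp_pos _).le
      rw [hη₀]; linarith
    have hmain := abs_queryProb_sub_approxProb_le hl (trigramVectors s g)
      (Z := fun i => meanPartitionFn s (β i)) hα (abs_nonneg B) hβB hb0.le hK1
      (fun i => ⟨by linarith [hZm i], meanPartitionFn_le (hβs i)⟩) ⟨hεm0, hm₀ m hmm⟩ hη0 hbadη q hq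
    refine hmain.trans (mul_le_mul_of_nonneg_right ?_ ?_)
    · set ℓ : ℝ := Real.log m / √m with hℓ
      have hℓ0 : 0 ≤ ℓ := by positivity
      set σ : ℝ := ∑ i : Fin q.1, (1 - α i) with hσ
      have hσ0 : 0 ≤ σ := Finset.sum_nonneg fun i _ => by linarith [(hα i).2]
      have h1 : η * (2 * K * m) ^ N ≤ η₀ * (2 * K) ^ N * H₁ * ℓ := by
        have := exp_neg_mul_log_sq_mul_pow_le (a := c₁ / 2) (by linarith) N m hm2
        calc η * (2 * K * m) ^ N = η₀ * (2 * K) ^ N *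
              (Real.exp (-(c₁ / 2) * Real.log m ^ 2) * (m : ℝ) ^ N) := by
              rw [hη, mul_pow]; ring
          _ ≤ η₀ * (2 * K) ^ N * (H₁ * ℓ) := mul_le_mul_of_nonneg_left this (by positivity)
          _ = _ := by ring
      -- Here the square root turns the rate `c₁ / 2` of `η` into `c₁ / 4`, and no power of `m` has
      -- to be absorbed.
      have h2 : √η * G ≤ √η₀ * H₂ * G * ℓ := by
        have := exp_neg_mul_log_sq_mul_pow_le (a := c₁ / 4) (by linarith) 0 m hm2
        rw [pow_zero, mul_one] at this
        have e : √η = √η₀ * Real.exp (-(c₁ / 4) * Real.log m ^ 2) := by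
          rw [hη, sqrt_mul_exp hη₀0.le]; congr 2; ring
        calc √η * G = √η₀ * G * Real.exp (-(c₁ / 4) * Real.log m ^ 2) := by rw [e]; ring
          _ ≤ √η₀ * G * (H₂ * ℓ) := mul_le_mul_of_nonneg_left this (by positivity)
          _ = _ := by ring
      have h3 : (2 * N * epsZ C₀ m + 2 * K * σ) * Q =
          2 * N * C₀ * Q * ℓ + 2 * K * Q * σ := by
        rw [epsZ]; ring
      have h4 : Y * ℓ ≤ C * ℓ := mul_le_mul_of_nonneg_right (by rw [hC]; linarith) hℓ0
      have h5 : 2 * K * Q * σ ≤ C * σ := mul_le_mul_of_nonneg_right (by rw [hC]; linarith) hσ0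
      have h6 : M ^ 2 / d ≤ C * (1 / d) := by
        rw [div_eq_mul_one_div]
        exact mul_le_mul_of_nonneg_right (by rw [hC]; linarith) (by positivity)
      have h7 : Y * ℓ = 2 * N * C₀ * Q * ℓ + η₀ * (2 * K) ^ N * H₁ * ℓ + √η₀ * H₂ * G * ℓ := by
        rw [hY]; ring
      have h8 : epsQuery C d α q = C * ℓ + C * σ + C * (1 / d) := by
        rw [epsQuery, ← hℓ, ← hσ]; ring
      rw [h8]
      refine (add_le_add (add_le_add (add_le_add h3.le h1) h2) h6).trans ?_
      refine le_trans (le_of_eq ?_) (add_le_add (add_le_add h4 h5) le_rfl)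
      rw [h7]
      ring
    · exact mul_nonneg (Finset.prod_nonneg fun i _ => div_nonneg (hα' i).1 (by linarith [hZm i]))
        (Real.exp_pos _).le
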